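/- **Setting.** Let $N,M_1,M_2,M_3\ge 1$ and $k$ be integers, $k\ge 0$, $\varepsilon=1/N$, $x_\ell=\varepsilon\ell$ for $\ell\in\mathbb Z^3$, $\Omega=\prod_{i=1}^3[-M_i+1,M_i]$ and $\mathfrak L=\mathbb Z^3\cap\frac1\varepsilon\Omega$. Let $R\subset\mathbb Z^3$ be finite with $\eta_1\eta_2\eta_3\neq0$ for all $\eta\in R$, and let $\phi_\eta:\mathbb R^3\to\mathbb R$ ($\eta\in R$) be $C^1$. Write $y_\ell=y(x_\ell)$ and $\overline D_\eta y_\ell=(y_{\ell+\eta}-y_\ell)/\varepsilon$. For $\ell,\eta\in\mathbb{Z}^3$ with $\eta_1\eta_2\eta_3\ne0$, the bond volume $B_{\ell,\eta}$ is the open box with edges parallel to the axes and main diagonal from $x_\ell$ to $x_{\ell+\eta}$. Its type A decomposition consists of the six tetrahedra whose edges are the edges of the box, this main diagonal, and the face diagonals starting at $x_\ell$ or at $x_{\ell+\eta}$. A lattice tetrahedron is a tetrahedron of the type A decomposition of a lattice cell $B_{\ell,(1,1,1)}$. A set of (closed) tetrahedra with lattice vertices is conforming if any two of them meet exactly in the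 (possibly empty) face spanned by their common vertices; two such sets are compatible if the same holds for any member of the first and any member of the second. **Regions.** $\Omega_a$ (atomistic) and $\Omega_*$ (continuum) are disjoint connected sets, each the interior of the closure of a union of lattice tetrahedra contained in $\Omega$, with $\Omega=\overline\Omega_a\cup\overline\Omega_*$; the interface is $\Gamma=\overline\Omega_a\cap\overline\Omega_*$. The set $\overline\Omega_a$ lies in the interior of $\Omega$, far enough from $\partial\Omega$ that every $\overline B_{\ell,\eta}$, $\eta\in R$, $\ell\in\mathbb Z^3$, meeting $\overline\Omega_a$ lies in the interior of $\Omega$. For $\eta\in R$, a bond volume is of class (a) if $\overline B_{\ell,\eta}\subset\Omega_a$, of class (b) if $B_{\ell,\eta}\subset\Omega_*$ or (periodic extension) $B_{\ell,\eta}\not\subset\Omega$, and belongs to $B_\Gamma$ otherwise. **Interface decompositions.** For each $\eta\in R$, each $B_{\ell,\eta}\in B_\Gamma$ has a conforming decomposition $\mathcal T(B_{\ell,\eta})$ into tetrahedra with vertices in $\varepsilon\mathbb Z^3$, each contained in $\overline\Omega_a$ or in $\overline\Omega_*$, those in $\overline\Omega_*$ being lattice tetrahedra. It is compatible with the decompositions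 of the six bond volumes $B_{\ell\pm\eta_ie_i,\eta}$ sharing a face with it, where bond volumes of class (a) carry the type A decomposition and those of class (b) the decomposition into lattice tetrahedra. Let $y^{\ell,\eta}$ be the function on $\overline B_{\ell,\eta}$ that is affine on each $T\in\mathcal T(B_{\ell,\eta})$ and equals $y$ at the vertices. **Finite element space.** Let $\mathcal T_c(\Omega_*)$ be a conforming decomposition of $\Omega_*$ into tetrahedra with vertices in $\varepsilon\mathbb Z^3$, such that every element $T$ with $\overline T\cap\Gamma\ne\emptyset$ is a lattice tetrahedron. The space $\boldsymbol V_{h,ac}$ consists of all $v\in C(\Omega;\mathbb R^3)$, periodic with period $\Omega$, that are affine on every lattice tetrahedron contained in $\overline\Omega_a$ and on every $T\in\mathcal T_c(\Omega_*)$ with $\overline T\cap\Gamma\neq\emptyset$, and polynomial of total degree at most $k$ on every other $T\in\mathcal T_c(\Omega_*)$. **Energy.** For $y=\mathsf Fx+v$ with a $3\times3$ matrix $\mathsf F$, $\det\mathsf F>0$, and $v\in\boldsymbol V_{h,ac}$, put $$\mathcal E_h\{y\}=\sum_{\eta\in R}\Big[\varepsilon^3\!\!\sum_{\ell\in\mathfrak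 L,\ \overline B_{\ell,\eta}\subset\Omega_a}\!\!\phi_\eta(\overline D_\eta y_\ell)+\int_{\Omega_*}\phi_\eta(\nabla y\,\eta)\,dx+\sum_{\ell\in\mathfrak L,\ B_{\ell,\eta}\in B_\Gamma}\frac1{|\eta_1\eta_2\eta_3|}\int_{B_{\ell,\eta}}\chi_{\Omega_a}\phi_\eta(\nabla y^{\ell,\eta}\,\eta)\,dx\Big].$$ **Proposition.** The energy $\mathcal E_h$ is free of ghost forces: for $y_{\mathsf F}(x)=\mathsf Fx$ and every $v\in\boldsymbol V_{h,ac}$, $$\langle D\mathcal E_h(y_{\mathsf F}),v\rangle=\frac{d}{dt}\Big|_{t=0}\mathcal E_h\{y_{\mathsf F}+tv\}=0 .$$ -/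

import Mathlib

noncomputable section

namespace ACCoupling

/-- Points (and vectors) of `ℝ³`. Norms play no role below; the measure is Lebesgue measure. -/
abbrev Pt := Fin 3 → ℝ

/-- Points of the unscaled lattice `ℤ³`; bond vectors `η` also live here. -/
abbrev LPt := Fin 3 → ℤ

/-- The lattice distance `ε = 1 / N`. -/
def spacing (N : ℕ) : ℝ := 1 / (N : ℝ)

/-- The scaled lattice point `x_ℓ = ε ℓ`. -/
def latticePt (N : ℕ) (l : LPt) : Pt := fun i => spacing N * (l i : ℝ)

/-- A bond vector `η`, regarded as a vector of `ℝ³`. -/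
def toVec (η : LPt) : Pt := fun i => (η i : ℝ)

/-- The continuum domain `Ω = ∏ᵢ [-Mᵢ + 1, Mᵢ]`. -/
def domain (M : Fin 3 → ℕ) : Set Pt := {x | ∀ i, -(M i : ℝ) + 1 ≤ x i ∧ x i ≤ (M i : ℝ)}

/-- `𝔏 = ℤ³ ∩ (1/ε) Ω`. -/
def latticePeriod (N : ℕ) (M : Fin 3 → ℕ) : Finset LPt :=
  Fintype.piFinset fun i => Finset.Icc ((N : ℤ) * (-(M i : ℤ) + 1)) ((N : ℤ) * (M i : ℤ))

/-! ### Tetrahedra with lattice vertices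

A tetrahedron is represented by the finite set of its vertices `ℓ ∈ ℤ³`. -/

/-- The closed tetrahedron in `ℝ³` with vertices `x_ℓ`, `ℓ ∈ T` (a lower-dimensional simplex if `T`
has fewer elements, and the empty set if `T = ∅`). -/
def hull (N : ℕ) (T : Finset LPt) : Set Pt := convexHull ℝ (latticePt N '' (T : Set LPt))

/-- `T` consists of the four vertices of a nondegenerate tetrahedron. -/
def IsTetrahedron (N : ℕ) (T : Finset LPt) : Prop :=
  T.card = 4 ∧ AffineIndependent ℝ (fun p : T => latticePt N (p : LPt))

/-- Any tetrahedron of `𝒮` and any tetrahedron of `𝒯` intersect exactly in the common face spanned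
by their common vertices (which may be empty). -/
def Conforming (N : ℕ) (𝒮 𝒯 : Set (Finset LPt)) : Prop :=
  ∀ S ∈ 𝒮, ∀ T ∈ 𝒯, hull N S ∩ hull N T = hull N (S ∩ T)

/-- `𝒯` is a conforming decomposition of `U` into tetrahedra with lattice vertices. -/
structure IsDecomposition (N : ℕ) (𝒯 : Finset (Finset LPt)) (U : Set Pt) : Prop where
  tetrahedron : ∀ T ∈ 𝒯, IsTetrahedron N T
  conforming : Conforming N 𝒯 𝒯
  cover : ⋃ T ∈ 𝒯, hull N T = closure U

/-- The `j`-th vertex of a monotone edge path from `ℓ` to `ℓ + η` in the box with main diagonal from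
`ℓ` to `ℓ + η`; `σ i` is the position at which the coordinate `i` is switched. -/
def pathVertex (l η : LPt) (σ : Equiv.Perm (Fin 3)) (j : Fin 4) : LPt :=
  fun i => l i + if (σ i : ℕ) < (j : ℕ) then η i else 0

/-- The six tetrahedra of the type A decomposition of the box with main diagonal from `x_ℓ` to
`x_{ℓ+η}`: their edges are the edges of the box, the main diagonal, the three face diagonals
starting at `x_ℓ` and the three face diagonals starting at `x_{ℓ+η}`. -/
def typeA (l η : LPt) : Finset (Finset LPt) :=
  Finset.univ.image fun σ : Equiv.Perm (Fin 3) => Finset.univ.image (pathVertex l η σ)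

/-- `𝒯_T(U)`: the lattice tetrahedra contained in (the closure of) `U`, that is, the tetrahedra of
the type A decompositions of the lattice cells, whose main diagonals run from `x_ℓ` to
`x_{ℓ+(1,1,1)}`. -/
def latticeTets (N : ℕ) (U : Set Pt) : Set (Finset LPt) :=
  {T | (∃ l : LPt, T ∈ typeA l 1) ∧ hull N T ⊆ closure U}

/-! ### Atomistic region, continuum region, interface -/

/-- `U` is the interior of the closure of a union of lattice tetrahedra of `Ω`, and is connected. -/
def IsLatticeRegion (N : ℕ) (M : Fin 3 → ℕ) (U : Set Pt) : Prop :=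
  (∃ 𝒮 ⊆ latticeTets N (domain M), U = interior (closure (⋃ T ∈ 𝒮, hull N T))) ∧ IsConnected U

/-- The bond volume `B_{ℓ,η}`: the open box with main diagonal from `x_ℓ` to `x_{ℓ+η}`. -/
def bondVolume (N : ℕ) (η l : LPt) : Set Pt :=
  {x | ∀ i, min (latticePt N l i) (latticePt N (l + η) i) < x i ∧
    x i < max (latticePt N l i) (latticePt N (l + η) i)}

/-- The splitting of `Ω` into the atomistic region `Ωa` and the continuum region `Ωs` (`Ω_*`).
The last two fields say that the closure of `Ωa` lies in the interior of `Ω`, at a distance from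
`∂Ω` that no bond volume can bridge. -/
structure IsSplitting (N : ℕ) (M : Fin 3 → ℕ) (R : Finset LPt) (Ωa Ωs : Set Pt) : Prop where
  region_a : IsLatticeRegion N M Ωa
  region_s : IsLatticeRegion N M Ωs
  disjoint : Disjoint Ωa Ωs
  cover : domain M = closure Ωa ∪ closure Ωs
  interior_domain : closure Ωa ⊆ interior (domain M)
  distance : ∀ η ∈ R, ∀ l : LPt, (closure (bondVolume N η l) ∩ closure Ωa).Nonempty →
    closure (bondVolume N η l) ⊆ interior (domain M)

/-- The interface `Γ`. -/
def interface (Ωa Ωs : Set Pt) : Set Pt := closure Ωa ∩ closure Ωs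

/-! ### The three classes of bond volumes -/

/-- Class (a): the closure of the bond volume is contained in the atomistic region. -/
def InAtomistic (N : ℕ) (Ωa : Set Pt) (η l : LPt) : Prop :=
  closure (bondVolume N η l) ⊆ Ωa

/-- Class (b): the bond volume is contained in `Ω_*`. By periodic extension, a bond volume that is
not contained in `Ω` is counted in this class. -/
def InContinuum (N : ℕ) (M : Fin 3 → ℕ) (Ωs : Set Pt) (η l : LPt) : Prop :=
  bondVolume N η l ⊆ Ωs ∨ ¬ bondVolume N η l ⊆ domain M

/-- Class (c), `B_Γ`: all other bond volumes. -/
def AtInterface (N : ℕ) (M : Fin 3 → ℕ) (Ωa Ωs : Set Pt) (η l : LPt) : Prop :=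
  ¬ InAtomistic N Ωa η l ∧ ¬ InContinuum N M Ωs η l

/-! ### Decompositions of the bond volumes at the interface -/

open Classical in
/-- The decomposition attached to an arbitrary bond volume, given decompositions `dec η ℓ` for the
bond volumes of class (c): type A for class (a), the lattice tetrahedra for class (b). -/
def bondMesh (N : ℕ) (M : Fin 3 → ℕ) (Ωa Ωs : Set Pt)
    (dec : LPt → LPt → Finset (Finset LPt)) (η l : LPt) : Set (Finset LPt) :=
  if InAtomistic N Ωa η l then (typeA l η : Set (Finset LPt))
  else if InContinuum N M Ωs η l then latticeTets N (bondVolume N η l)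
  else (dec η l : Set (Finset LPt))

/-- Admissible decompositions `𝒯(B_{ℓ,η}) = dec η ℓ` of the bond volumes of class (c). -/
structure IsInterfaceDecomposition (N : ℕ) (M : Fin 3 → ℕ) (R : Finset LPt) (Ωa Ωs : Set Pt)
    (dec : LPt → LPt → Finset (Finset LPt)) : Prop where
  /-- Each bond volume of class (c) is decomposed conformingly into tetrahedra with lattice
  vertices. -/
  decomposition : ∀ η ∈ R, ∀ l, AtInterface N M Ωa Ωs η l →
    IsDecomposition N (dec η l) (bondVolume N η l)
  /-- No tetrahedron crosses the interface. -/
  resolves : ∀ η ∈ R, ∀ l, AtInterface N M Ωa Ωs η l → ∀ T ∈ dec η l,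
    hull N T ⊆ closure Ωa ∨ hull N T ⊆ closure Ωs
  /-- In `Ω_*` only tetrahedra of type A decompositions of lattice cells are used. -/
  continuum : ∀ η ∈ R, ∀ l, AtInterface N M Ωa Ωs η l → ∀ T ∈ dec η l,
    hull N T ⊆ closure Ωs → T ∈ latticeTets N Ωs
  /-- Compatibility with the decompositions of the bond volumes sharing a face with it. -/
  compatible : ∀ η ∈ R, ∀ l, AtInterface N M Ωa Ωs η l → ∀ i : Fin 3,
    Conforming N (dec η l) (bondMesh N M Ωa Ωs dec η (l + Pi.single i (η i))) ∧
    Conforming N (dec η l) (bondMesh N M Ωa Ωs dec η (l - Pi.single i (η i)))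

/-- `w` are barycentric coordinates of `x` with respect to the vertices of `T`. -/
def IsBarycentric (N : ℕ) (T : Finset LPt) (w : LPt → ℝ) (x : Pt) : Prop :=
  (∀ p ∈ T, 0 ≤ w p) ∧ ∑ p ∈ T, w p = 1 ∧ ∑ p ∈ T, w p • latticePt N p = x

open Classical in
/-- The piecewise linear interpolant of the lattice values `y(x_ℓ)`: it is affine on every
tetrahedron of `𝒯` and equals `y` at its vertices. (For a conforming `𝒯` the value does not depend
on the choice of a tetrahedron containing `x`; outside all tetrahedra the value is `0`.) -/
def interpolant (N : ℕ) (𝒯 : Finset (Finset LPt)) (y : Pt → Pt) (x : Pt) : Pt :=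
  if h : ∃ q : Finset LPt × (LPt → ℝ), q.1 ∈ 𝒯 ∧ IsBarycentric N q.1 q.2 x then
    ∑ p ∈ h.choose.1, h.choose.2 p • y (latticePt N p)
  else 0

/-! ### The finite element spaces -/

/-- `𝒯_c(Ω_*)`: a conforming decomposition of `Ω_*` into tetrahedra with lattice vertices, such that
all its elements touching `Γ` are lattice tetrahedra. -/
structure IsContinuumMesh (N : ℕ) (Ωa Ωs : Set Pt) (𝒯c : Finset (Finset LPt)) : Prop where
  decomposition : IsDecomposition N 𝒯c Ωs
  lattice_at_interface : ∀ T ∈ 𝒯c, (hull N T ∩ interface Ωa Ωs).Nonempty → T ∈ latticeTets N Ωs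

/-- `v` restricted to `S` is (componentwise) a polynomial of total degree at most `k`. -/
def IsPolyOn (k : ℕ) (v : Pt → Pt) (S : Set Pt) : Prop :=
  ∀ i : Fin 3, ∃ p : MvPolynomial (Fin 3) ℝ,
    p.totalDegree ≤ k ∧ ∀ x ∈ S, v x i = MvPolynomial.eval x p

/-- The high-order finite element space `V_{h,ac}(Ω_*)` on the continuum region. -/
structure MemContinuumSpace (N k : ℕ) (Ωa Ωs : Set Pt) (𝒯c : Finset (Finset LPt))
    (v : Pt → Pt) : Prop where
  continuous : ContinuousOn v (closure Ωs)
  linear : ∀ T ∈ 𝒯c, (hull N T ∩ interface Ωa Ωs).Nonempty → IsPolyOn 1 v (hull N T)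
  poly : ∀ T ∈ 𝒯c, ¬ (hull N T ∩ interface Ωa Ωs).Nonempty → IsPolyOn k v (hull N T)

/-- The coupled periodic space `V_{h,ac}`. Only the values of `v` on `Ω` are relevant. -/
structure MemCoupledSpace (N k : ℕ) (M : Fin 3 → ℕ) (Ωa Ωs : Set Pt)
    (𝒯c : Finset (Finset LPt)) (v : Pt → Pt) : Prop where
  continuous : ContinuousOn v (domain M)
  atomistic : ∀ T ∈ latticeTets N Ωa, IsPolyOn 1 v (hull N T)
  continuum : MemContinuumSpace N k Ωa Ωs 𝒯c v
  periodic : ∀ (i : Fin 3), ∀ x ∈ domain M,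
    x + Pi.single i (2 * (M i : ℝ) - 1) ∈ domain M →
      v (x + Pi.single i (2 * (M i : ℝ) - 1)) = v x

/-! ### The energy -/

/-- The difference quotient `D̄_η y_ℓ = (y_{ℓ+η} - y_ℓ) / ε`, where `y_ℓ = y(x_ℓ)`. -/
def diffQuot (N : ℕ) (η : LPt) (y : Pt → Pt) (l : LPt) : Pt :=
  (spacing N)⁻¹ • (y (latticePt N (l + η)) - y (latticePt N l))

open Classical in
/-- The contribution of the atomistic region, a sum over the bond volumes of class (a). -/
def energyAtomistic (N : ℕ) (M : Fin 3 → ℕ) (Ωa : Set Pt) (φ : Pt → ℝ) (η : LPt)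
    (y : Pt → Pt) : ℝ :=
  spacing N ^ 3 * ∑ l ∈ latticePeriod N M with InAtomistic N Ωa η l, φ (diffQuot N η y l)

/-- The Cauchy--Born contribution of the continuum region, `∫_{Ω_*} φ_η(∇y η) dx`. -/
def energyContinuum (Ωs : Set Pt) (φ : Pt → ℝ) (η : LPt) (y : Pt → Pt) : ℝ :=
  ∫ x in Ωs, φ (fderiv ℝ y x (toVec η))

open Classical in
/-- The contribution of the bond volumes of class (c), with `y^{ℓ,η}` the piecewise linear
interpolant of `{y_ℓ}` on the decomposition of the bond volume. -/
def energyInterface (N : ℕ) (M : Fin 3 → ℕ) (Ωa Ωs : Set Pt)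
    (dec : LPt → LPt → Finset (Finset LPt)) (φ : Pt → ℝ) (η : LPt) (y : Pt → Pt) : ℝ :=
  ∑ l ∈ latticePeriod N M with AtInterface N M Ωa Ωs η l,
    (1 / |((η 0 * η 1 * η 2 : ℤ) : ℝ)|) *
      ∫ x in bondVolume N η l, Ωa.indicator
        (fun x => φ (fderiv ℝ (interpolant N (dec η l) y) x (toVec η))) x

/-- The coupled energy `ℰ_h = ∑_{η ∈ R} ℰ_{h,η}`. -/
def coupledEnergy (N : ℕ) (M : Fin 3 → ℕ) (R : Finset LPt) (φ : LPt → Pt → ℝ) (Ωa Ωs : Set Pt)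
    (dec : LPt → LPt → Finset (Finset LPt)) (y : Pt → Pt) : ℝ :=
  ∑ η ∈ R, (energyAtomistic N M Ωa (φ η) η y + energyContinuum Ωs (φ η) η y +
    energyInterface N M Ωa Ωs dec (φ η) η y)

end ACCoupling

end

/-!
Fix `η` and a residue class `r` modulo `η`. The closed bond volumes of `r + ηm`, `m ∈ ℤ³`, tile
`ℝ³`, and by conformity and compatibility of the decompositions the local interpolants on
`closure Ωa` and the test function `v` on `closure Ωs` agree wherever two of them meet. They
therefore glue to a Lipschitz field with periodic boundary values, so the integral over `Ω` of its
derivative in the direction `η` vanishes.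

At the homogeneous deformation the derivative of each part of the energy is the same linear form
`Dφ_η(F η)` applied to an integrated strain. For a bond volume of class (a) the type A interpolant
has the derivative `D̄_η v_ℓ` in the direction of the diagonal almost everywhere, because each of
the six tetrahedra contains the diagonal, so the bond sum is a sum of integrated strains too.
Each `ℓ` lies in exactly one of the `|η₁η₂η₃|` residue classes; averaging the vanishing integrals
over them gives exactly the sum of the three integrated strains.
-/

noncomputable section

namespace ACCoupling

open Set Filter Topology MeasureTheory
open scoped NNReal

theorem dist_le_mul_of_finite_closed_cover {Y : Type*} [PseudoMetricSpace Y] {g : ℝ → Y} {C : ℝ≥0}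
    (𝒦 : Finset (Set ℝ)) (hcl : ∀ K ∈ 𝒦, IsClosed K) (hlip : ∀ K ∈ 𝒦, LipschitzOnWith C g K)
    {a b : ℝ} (hab : a ≤ b) (hcov : Icc a b ⊆ ⋃ K ∈ 𝒦, K) :
    dist (g a) (g b) ≤ C * (b - a) := by
  classical
  induction 𝒦 using Finset.strongInduction generalizing a with
  | H 𝒦 ih =>
    obtain ⟨K, hK, haK⟩ := mem_iUnion₂.1 (hcov (left_mem_Icc.2 hab))
    -- Leave `K` at the last point `c` where it meets `[a, b]`: the other sets cover `[c, b]`.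
    obtain ⟨c, ⟨hcK, hac, hcb⟩, hmax⟩ := (isCompact_Icc.inter_left (hcl K hK)).exists_isGreatest
      (⟨a, haK, left_mem_Icc.2 hab⟩ : (K ∩ Icc a b).Nonempty)
    have hdist : dist (g a) (g c) ≤ C * (c - a) := by
      simpa [Real.dist_eq, abs_sub_comm a c, abs_of_nonneg (sub_nonneg.2 hac)]
        using (hlip K hK).dist_le_mul a haK c hcK
    rcases hcb.eq_or_lt with rfl | hcb'
    · exact hdist
    have hcl' : ∀ K' ∈ 𝒦.erase K, IsClosed K' := fun K' hK' => hcl K' (Finset.mem_of_mem_erase hK')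
    have hcov_Ioc : Ioc c b ⊆ ⋃ K' ∈ 𝒦.erase K, K' := fun x hx => by
      obtain ⟨K', hK', hxK'⟩ := mem_iUnion₂.1 (hcov ⟨hac.trans hx.1.le, hx.2⟩)
      refine mem_iUnion₂.2 ⟨K', Finset.mem_erase.2 ⟨?_, hK'⟩, hxK'⟩
      rintro rfl
      exact (hmax ⟨hxK', hac.trans hx.1.le, hx.2⟩).not_gt hx.1
    have hcov_Icc : Icc c b ⊆ ⋃ K' ∈ 𝒦.erase K, K' := by
      rw [← closure_Ioc hcb'.ne]
      exact closure_minimal hcov_Ioc ((Finset.finite_toSet _).isClosed_biUnion hcl')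
    calc dist (g a) (g b) ≤ dist (g a) (g c) + dist (g c) (g b) := dist_triangle _ _ _
      _ ≤ C * (c - a) + C * (b - c) := add_le_add hdist <|
          ih _ (Finset.erase_ssubset hK) hcl' (fun K' hK' => hlip K' (Finset.mem_of_mem_erase hK'))
            hcb hcov_Icc
      _ = C * (b - a) := by ring

theorem exists_lipschitzOnWith_of_finite_closed_cover {E Y : Type*} [NormedAddCommGroup E]
    [NormedSpace ℝ E] [PseudoMetricSpace Y] {f : E → Y} {s : Set E} (hs : Convex ℝ s)
    {𝒦 : Set (Set E)} (hfin : 𝒦.Finite) (hcl : ∀ K ∈ 𝒦, IsClosed K)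
    (hlip : ∀ K ∈ 𝒦, ∃ C, LipschitzOnWith C f K) (hcov : s ⊆ ⋃₀ 𝒦) :
    ∃ C, LipschitzOnWith C f s := by
  classical
  choose! c hc using hlip
  set C : ℝ≥0 := ∑ K ∈ hfin.toFinset, c K
  have hcC : ∀ K ∈ 𝒦, c K ≤ C := fun K hK =>
    Finset.single_le_sum (f := c) (fun _ _ => zero_le) (hfin.mem_toFinset.2 hK)
  refine ⟨C, LipschitzOnWith.of_dist_le_mul fun x hx y hy => ?_⟩
  set γ : ℝ →ᵃ[ℝ] E := AffineMap.lineMap x y with hγ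
  have hγ_lip : LipschitzWith (nndist x y) γ := lipschitzWith_lineMap (𝕜 := ℝ) x y
  have hdist := dist_le_mul_of_finite_closed_cover (g := f ∘ γ) (C := C * nndist x y)
    (hfin.toFinset.image fun K => γ ⁻¹' K) ?_ ?_ zero_le_one ?_
  · simpa [hγ] using hdist
  · simp only [Finset.forall_mem_image, hfin.mem_toFinset]
    exact fun K hK => (hcl K hK).preimage hγ_lip.continuous
  · simp only [Finset.forall_mem_image, hfin.mem_toFinset]
    exact fun K hK => ((hc K hK).weaken (hcC K hK)).comp hγ_lip.lipschitzOnWith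
      (mapsTo_preimage γ K)
  · intro t ht
    obtain ⟨K, hK, hmem⟩ := hcov (hs.lineMap_mem hx hy ht)
    exact mem_iUnion₂.2 ⟨γ ⁻¹' K, Finset.mem_image_of_mem _ (hfin.mem_toFinset.2 hK), hmem⟩

section LipschitzOnConvex

variable {E F : Type*} [NormedAddCommGroup E] [NormedSpace ℝ E] [FiniteDimensional ℝ E]
  [MeasurableSpace E] [BorelSpace E] {μ : Measure E} [μ.IsAddHaarMeasure]
  [NormedAddCommGroup F] [NormedSpace ℝ F] [FiniteDimensional ℝ F]
  {f : E → F} {s : Set E} {C : ℝ≥0}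

theorem ae_mem_nhds_and_differentiableAt (hs : Convex ℝ s) (hf : LipschitzOnWith C f s) :
    ∀ᵐ x ∂μ, x ∈ s → s ∈ 𝓝 x ∧ DifferentiableAt ℝ f x := by
  filter_upwards [measure_eq_zero_iff_ae_notMem.1 (hs.addHaar_frontier μ),
    hf.ae_differentiableWithinAt_of_mem (μ := μ)] with x hx hdiff hxs
  have hnhds : s ∈ 𝓝 x := by
    rw [← mem_interior_iff_mem_nhds]
    by_contra h
    exact hx ⟨subset_closure hxs, h⟩
  exact ⟨hnhds, (hdiff hxs).differentiableAt hnhds⟩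

theorem ae_norm_fderiv_apply_le (hs : Convex ℝ s) (hf : LipschitzOnWith C f s) (d : E) :
    ∀ᵐ x ∂μ, x ∈ s → ‖fderiv ℝ f x d‖ ≤ C * ‖d‖ := by
  filter_upwards [ae_mem_nhds_and_differentiableAt hs hf] with x hx hxs
  refine (ContinuousLinearMap.le_opNorm _ _).trans ?_
  gcongr
  exact norm_fderiv_le_of_lipschitzOn ℝ (hx hxs).1 hf

theorem integrableOn_fderiv_apply (hs : Convex ℝ s) (hsc : IsCompact s)
    (hf : LipschitzOnWith C f s) (d : E) : IntegrableOn (fun x => fderiv ℝ f x d) s μ := by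
  borelize F
  have := FiniteDimensional.complete ℝ F
  refine Measure.integrableOn_of_bounded (M := C * ‖d‖) hsc.measure_lt_top.ne
    (measurable_fderiv_apply_const ℝ f d).aestronglyMeasurable ?_
  rw [ae_restrict_iff' hsc.measurableSet]
  exact ae_norm_fderiv_apply_le hs hf d

end LipschitzOnConvex

theorem hasDerivAt_add_smul_const {V : Type*} [NormedAddCommGroup V] [NormedSpace ℝ V] (a d : V)
    (t : ℝ) : HasDerivAt (fun s : ℝ => a + s • d) d t := by
  simpa using ((hasDerivAt_id t).smul_const d).const_add a

theorem integral_fderiv_add_smul_eq_sub {E : Type*} [NormedAddCommGroup E] [NormedSpace ℝ E]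
    {f : E → ℝ} {s : Set E} {C : ℝ≥0} (hf : LipschitzOnWith C f s) {x d : E} {a b : ℝ}
    (hs : ∀ t ∈ uIcc a b, x + t • d ∈ s)
    (hd : ∀ᵐ t, t ∈ uIcc a b → DifferentiableAt ℝ f (x + t • d)) :
    ∫ t in a..b, fderiv ℝ f (x + t • d) d = f (x + b • d) - f (x + a • d) := by
  have hcurve : LipschitzWith ‖d‖₊ fun t : ℝ => x + t • d :=
    LipschitzWith.of_dist_le_mul fun t u => by
      rw [dist_add_left, dist_eq_norm, ← sub_smul, norm_smul, mul_comm, coe_nnnorm, dist_eq_norm]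
  have hftc := (hf.comp hcurve.lipschitzOnWith hs).absolutelyContinuousOnInterval
    |>.integral_deriv_eq_sub
  refine Eq.trans (intervalIntegral.integral_congr_ae ?_) hftc
  filter_upwards [hd] with t ht htab
  exact ((ht (uIoc_subset_uIcc htab)).hasFDerivAt.comp_hasDerivAt t
    (hasDerivAt_add_smul_const x d t)).deriv.symm

theorem setIntegral_Icc_eq_integral_insertNth {n : ℕ} (i : Fin (n + 1)) {a b : Fin (n + 1) → ℝ}
    {g : (Fin (n + 1) → ℝ) → ℝ} (hg : IntegrableOn g (Icc a b)) :
    ∫ x in Icc a b, g x =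
      ∫ z in Icc (i.removeNth a) (i.removeNth b), ∫ t in Icc (a i) (b i), g (i.insertNth t z) := by
  set e := (MeasurableEquiv.piFinSuccAbove (fun _ : Fin (n + 1) => ℝ) i).symm
  have hmp : MeasurePreserving e :=
    (volume_preserving_piFinSuccAbove (fun _ : Fin (n + 1) => ℝ) i).symm _
  have hpre : e ⁻¹' Icc a b = Icc (a i) (b i) ×ˢ Icc (i.removeNth a) (i.removeNth b) := by
    ext ⟨t, z⟩
    change i.insertNth t z ∈ Icc a b ↔ _
    exact Fin.insertNth_mem_Icc
  rw [← hmp.setIntegral_preimage_emb e.measurableEmbedding, hpre, Measure.volume_eq_prod,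
    ← Measure.prod_restrict, integral_prod_symm]
  · rfl
  · rw [Measure.prod_restrict, ← Measure.volume_eq_prod, ← hpre]
    exact (hmp.integrableOn_comp_preimage e.measurableEmbedding).2 hg

theorem ae_ae_insertNth {n : ℕ} (i : Fin (n + 1)) {p : (Fin (n + 1) → ℝ) → Prop}
    (hp : ∀ᵐ x, p x) : ∀ᵐ z : Fin n → ℝ, ∀ᵐ t : ℝ, p (i.insertNth t z) := by
  have hmp := ((volume_preserving_piFinSuccAbove (fun _ : Fin (n + 1) => ℝ) i).symm _).comp
    (Measure.measurePreserving_swap (μ := (volume : Measure (Fin n → ℝ))) (ν := volume))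
  exact Measure.ae_ae_of_ae_prod (hmp.quasiMeasurePreserving.ae hp)

theorem integral_fderiv_single_eq_zero {n : ℕ} {a b : Fin (n + 1) → ℝ} (i : Fin (n + 1))
    {f : (Fin (n + 1) → ℝ) → ℝ} {C : ℝ≥0} (hf : LipschitzOnWith C f (Icc a b))
    (hper : ∀ x ∈ Icc a b, x i = a i → f (Function.update x i (b i)) = f x) :
    ∫ x in Icc a b, fderiv ℝ f x (Pi.single i 1) = 0 := by
  rcases (Icc a b).eq_empty_or_nonempty with hemp | hne
  · simp [hemp]
  have hab : a i ≤ b i := nonempty_Icc.1 hne i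
  rw [setIntegral_Icc_eq_integral_insertNth i
    (integrableOn_fderiv_apply (convex_Icc a b) isCompact_Icc hf _)]
  refine integral_eq_zero_of_ae ?_
  rw [EventuallyEq, ae_restrict_iff' measurableSet_Icc]
  filter_upwards [ae_ae_insertNth i (ae_mem_nhds_and_differentiableAt (convex_Icc a b) hf)]
    with z hz hzab
  obtain ⟨x₀, hline⟩ : ∃ x₀ : Fin (n + 1) → ℝ, ∀ t : ℝ,
      i.insertNth t z = x₀ + t • Pi.single i 1 := ⟨i.insertNth 0 z, fun t => by
    ext j
    refine Fin.succAboveCases i ?_ (fun k => ?_) j <;> simp⟩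
  have hmem : ∀ t ∈ Icc (a i) (b i), (i.insertNth t z : Fin (n + 1) → ℝ) ∈ Icc a b :=
    fun t ht => Fin.insertNth_mem_Icc.2 ⟨ht, hzab⟩
  simp only [hline] at hmem hz ⊢
  rw [Pi.zero_apply, integral_Icc_eq_integral_Ioc, ← intervalIntegral.integral_of_le hab,
    integral_fderiv_add_smul_eq_sub hf (by rwa [uIcc_of_le hab])
      (by rw [uIcc_of_le hab]; filter_upwards [hz] with t ht htab using (ht (hmem t htab)).2),
    sub_eq_zero, ← hline, ← hline, ← hper _ (by rw [hline]; exact hmem _ (left_mem_Icc.2 hab))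
      (Fin.insertNth_apply_same ..), Fin.update_insertNth]

theorem integral_fderiv_eq_zero_of_periodic {n : ℕ} {F : Type*} [NormedAddCommGroup F]
    [NormedSpace ℝ F] [FiniteDimensional ℝ F] {a b : Fin (n + 1) → ℝ}
    {f : (Fin (n + 1) → ℝ) → F} {C : ℝ≥0} (hf : LipschitzOnWith C f (Icc a b))
    (hper : ∀ i, ∀ x ∈ Icc a b, x i = a i → f (Function.update x i (b i)) = f x)
    (d : Fin (n + 1) → ℝ) : ∫ x in Icc a b, fderiv ℝ f x d = 0 := by
  have hconv : Convex ℝ (Icc a b) := convex_Icc a b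
  have hint := fun i => integrableOn_fderiv_apply (μ := volume) hconv isCompact_Icc hf
    (Pi.single i 1)
  have hsingle : ∀ i, ∫ x in Icc a b, fderiv ℝ f x (Pi.single i 1) = 0 := fun i => by
    refine SeparatingDual.eq_zero_of_forall_dual_eq_zero (R := ℝ) fun L => ?_
    rw [← ContinuousLinearMap.integral_comp_comm L (hint i),
      ← integral_fderiv_single_eq_zero i (L.lipschitz.comp_lipschitzOnWith hf)
        fun x hx hxi => by rw [Function.comp_apply, hper i x hx hxi, Function.comp_apply]]
    refine setIntegral_congr_ae measurableSet_Icc ?_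
    filter_upwards [ae_mem_nhds_and_differentiableAt (μ := volume) hconv hf] with x hx hxs
    rw [(L.hasFDerivAt.comp x (hx hxs).2.hasFDerivAt).fderiv, ContinuousLinearMap.comp_apply]
  have hd : ∀ x, fderiv ℝ f x d = ∑ i, d i • fderiv ℝ f x (Pi.single i 1) := fun x => by
    conv_lhs => rw [pi_eq_sum_univ' d]
    simp only [map_sum, map_smul]
  simp only [hd]
  rw [integral_finsetSum Finset.univ (f := fun i x => d i • fderiv ℝ f x (Pi.single i 1))
    fun i _ => (hint i).smul (d i)]
  simp only [integral_smul, hsingle, smul_zero, Finset.sum_const_zero]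

theorem hasDerivAt_integral_comp_add_smul {α E : Type*} [MeasurableSpace α] {μ : Measure α}
    [IsFiniteMeasure μ] [NormedAddCommGroup E] [NormedSpace ℝ E] [CompleteSpace E]
    [MeasurableSpace E] [BorelSpace E] {φ : E → ℝ} (hφm : Measurable φ) {A : E}
    (hφ : DifferentiableAt ℝ φ A) {G : α → E} (hG : AEStronglyMeasurable G μ) {C : ℝ}
    (hC : ∀ᵐ x ∂μ, ‖G x‖ ≤ C) :
    HasDerivAt (fun t : ℝ => ∫ x, φ (A + t • G x) ∂μ) (fderiv ℝ φ A (∫ x, G x ∂μ)) 0 := by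
  set D := fderiv ℝ φ A
  obtain ⟨c, hc⟩ := hφ.hasFDerivAt.isBigO_sub.bound
  obtain ⟨r, hr, hball⟩ := Metric.eventually_nhds_iff_ball.1 hc
  have hC' : ∀ᵐ x ∂μ, ‖G x‖ ≤ |C| := hC.mono fun x hx => hx.trans (le_abs_self C)
  have hsmall : ∀ t ∈ Metric.ball (0 : ℝ) (r / (|C| + 1)), ∀ g : E, ‖g‖ ≤ |C| →
      A + t • g ∈ Metric.ball A r := fun t ht g hg => by
    rw [mem_ball_zero_iff, lt_div_iff₀ (by positivity)] at ht
    rw [mem_ball_iff_norm, add_sub_cancel_left, norm_smul]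
    exact (mul_le_mul_of_nonneg_left (hg.trans (le_add_of_nonneg_right zero_le_one))
      (norm_nonneg t)).trans_lt ht
  have hmeas : ∀ t : ℝ, AEStronglyMeasurable (fun x => φ (A + t • G x)) μ := fun t =>
    (hφm.comp_aemeasurable
      (aestronglyMeasurable_const.add (hG.const_smul t)).aemeasurable).aestronglyMeasurable
  have hlip : ∀ᵐ x ∂μ, ∀ t ∈ Metric.ball (0 : ℝ) (r / (|C| + 1)),
      ‖φ (A + t • G x) - φ (A + (0 : ℝ) • G x)‖ ≤ |c| * |C| * ‖t - 0‖ := by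
    filter_upwards [hC'] with x hx t ht
    calc ‖φ (A + t • G x) - φ (A + (0 : ℝ) • G x)‖ ≤ c * ‖t • G x‖ := by
          simpa using hball _ (hsmall t ht (G x) hx)
      _ ≤ |c| * (‖t‖ * |C|) := by rw [norm_smul]; gcongr; exact le_abs_self c
      _ = |c| * |C| * ‖t - 0‖ := by rw [sub_zero]; ring
  have hderiv := hasFDerivAt_integral_of_dominated_loc_of_lip'
    (F' := fun x => ContinuousLinearMap.toSpanSingleton ℝ (D (G x)))
    (Metric.ball_mem_nhds (0 : ℝ) (div_pos hr (by positivity))) (fun t _ => hmeas t)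
    (by simp) (((ContinuousLinearMap.toSpanSingletonCLE.continuous.comp
      D.continuous).comp_aestronglyMeasurable hG)) hlip (integrable_const _) ?_
  · have h := hderiv.2.hasDerivAt
    rwa [ContinuousLinearMap.integral_apply hderiv.1,
      show (∫ x, ContinuousLinearMap.toSpanSingleton ℝ (D (G x)) 1 ∂μ) = D (∫ x, G x ∂μ) by
        simpa using D.integral_comp_comm (Integrable.of_bound hG C hC)] at h
  · refine Eventually.of_forall fun x => HasDerivAt.hasFDerivAt ?_
    exact HasFDerivAt.comp_hasDerivAt 0 (by simpa using hφ.hasFDerivAt)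
      (hasDerivAt_add_smul_const A (G x) 0)

theorem eval_sum_smul_of_totalDegree_le_one {σ ι : Type*} {p : MvPolynomial σ ℝ}
    (hp : p.totalDegree ≤ 1) {s : Finset ι} {w : ι → ℝ} (hw : ∑ i ∈ s, w i = 1)
    (x : ι → σ → ℝ) :
    MvPolynomial.eval (∑ i ∈ s, w i • x i) p = ∑ i ∈ s, w i * MvPolynomial.eval (x i) p := by
  have hmono : ∀ d ∈ p.support, (∏ j ∈ d.support, (∑ i ∈ s, w i • x i) j ^ d j) =
      ∑ i ∈ s, w i * ∏ j ∈ d.support, x i j ^ d j := fun d hd => by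
    have hd1 : d.degree ≤ 1 := (MvPolynomial.le_totalDegree hd).trans hp
    rcases Nat.le_one_iff_eq_zero_or_eq_one.1 hd1 with h0 | h1
    · obtain rfl := (Finsupp.degree_eq_zero_iff d).1 h0
      simp [hw]
    · obtain ⟨j, rfl⟩ : d ∈ range fun a : σ => Finsupp.single a 1 := by
        rwa [Finsupp.range_single_one]
      simp
  simp only [MvPolynomial.eval_eq, Finset.mul_sum]
  rw [Finset.sum_congr rfl fun d hd => by rw [hmono d hd, Finset.mul_sum], Finset.sum_comm]
  exact Finset.sum_congr rfl fun i _ => Finset.sum_congr rfl fun d _ => by ring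

theorem IsPolyOn.exists_lipschitzOnWith {k : ℕ} {v : Pt → Pt} {S : Set Pt} (hv : IsPolyOn k v S)
    (hS : IsCompact S) : ∃ C, LipschitzOnWith C v S := by
  choose p _ hvp using hv
  have hcd : ContDiff ℝ 1 fun (x : Pt) i => MvPolynomial.eval x (p i) :=
    contDiff_pi.2 fun i => (AnalyticOnNhd.eval_mvPolynomial (p i)).contDiff
  obtain ⟨C, hC⟩ := hcd.locallyLipschitz.locallyLipschitzOn.exists_lipschitzOnWith_of_compact hS
  exact ⟨C, fun x hx y hy => by
    rw [funext fun i => hvp i x hx, funext fun i => hvp i y hy]; exact hC hx hy⟩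

theorem IsPolyOn.sum_smul {v : Pt → Pt} {S : Set Pt} (hv : IsPolyOn 1 v S) (hS : Convex ℝ S)
    {ι : Type*} {s : Finset ι} {w : ι → ℝ} (hw₀ : ∀ i ∈ s, 0 ≤ w i) (hw : ∑ i ∈ s, w i = 1)
    {x : ι → Pt} (hx : ∀ i ∈ s, x i ∈ S) :
    v (∑ i ∈ s, w i • x i) = ∑ i ∈ s, w i • v (x i) := by
  ext j
  obtain ⟨p, hp, hvp⟩ := hv j
  rw [hvp _ (hS.sum_mem hw₀ hw hx), eval_sum_smul_of_totalDegree_le_one hp hw]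
  simp only [Finset.sum_apply, Pi.smul_apply, smul_eq_mul]
  exact Finset.sum_congr rfl fun i hi => by rw [hvp _ (hx i hi)]

theorem spacing_pos {N : ℕ} (hN : 0 < N) : 0 < spacing N :=
  one_div_pos.2 (Nat.cast_pos.2 hN)

theorem latticePt_add (N : ℕ) (l η : LPt) :
    latticePt N (l + η) = latticePt N l + spacing N • toVec η := by
  ext i
  simp [latticePt, toVec, mul_add]

theorem latticePt_injective {N : ℕ} (hN : 0 < N) : Function.Injective (latticePt N) :=
  fun p q h => funext fun i => by
    simpa [latticePt, (spacing_pos hN).ne'] using congrFun h i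

theorem isCompact_hull (N : ℕ) (T : Finset LPt) : IsCompact (hull N T) :=
  (T.finite_toSet.image _).isCompact_convexHull ℝ

theorem latticePt_mem_hull {N : ℕ} {T : Finset LPt} {p : LPt} (hp : p ∈ T) :
    latticePt N p ∈ hull N T := subset_convexHull ℝ _ (mem_image_of_mem _ hp)

theorem mem_hull_iff {N : ℕ} (hN : 0 < N) {T : Finset LPt} {x : Pt} :
    x ∈ hull N T ↔ ∃ w, IsBarycentric N T w x := by
  classical
  refine ⟨fun h => ?_, fun ⟨w, hw0, hw1, hwx⟩ => hwx ▸ (convex_convexHull ℝ _).sum_mem hw0 hw1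
    fun p hp => latticePt_mem_hull hp⟩
  rw [hull, ← Finset.coe_image, Finset.mem_convexHull'] at h
  obtain ⟨w, hw0, hw1, hwx⟩ := h
  rw [Finset.sum_image (latticePt_injective hN).injOn] at hw1 hwx
  exact ⟨w ∘ latticePt N, fun p hp => hw0 _ (Finset.mem_image_of_mem _ hp), hw1, hwx⟩

/-- The vertices of a tetrahedron as an affine basis of `ℝ³`; its coordinates are the barycentric
coordinates. -/
def IsTetrahedron.affineBasis {N : ℕ} {T : Finset LPt} (hT : IsTetrahedron N T) :
    AffineBasis T ℝ Pt :=
  ⟨_, hT.2, hT.2.affineSpan_eq_top_iff_card_eq_finrank_add_one.2 (by simp [hT.1])⟩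

theorem IsTetrahedron.coord_eq {N : ℕ} {T : Finset LPt} (hT : IsTetrahedron N T) {w : LPt → ℝ}
    {x : Pt} (hw : IsBarycentric N T w x) (p : T) : hT.affineBasis.coord p x = w p := by
  have hsum : ∑ q : T, w q = 1 := by rw [Finset.sum_coe_sort T w, hw.2.1]
  have hx : Finset.univ.affineCombination ℝ hT.affineBasis (fun q : T => w q) = x := by
    rw [Finset.affineCombination_eq_linear_combination _ _ _ hsum, ← hw.2.2,
      ← Finset.sum_coe_sort T fun q => w q • latticePt N q]
    rfl
  rw [← hx, AffineBasis.coord_apply_combination_of_mem _ (Finset.mem_univ p) hsum]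

theorem IsTetrahedron.weights_eq {N : ℕ} {T : Finset LPt} (hT : IsTetrahedron N T)
    {w w' : LPt → ℝ} {x : Pt} (hw : IsBarycentric N T w x) (hw' : IsBarycentric N T w' x) :
    ∀ p ∈ T, w p = w' p :=
  fun p hp => (hT.coord_eq hw ⟨p, hp⟩).symm.trans (hT.coord_eq hw' ⟨p, hp⟩)

theorem IsTetrahedron.exists_lipschitzOnWith {N : ℕ} (hN : 0 < N) {T : Finset LPt}
    (hT : IsTetrahedron N T) {f : Pt → Pt} {g : LPt → Pt} {s : Set Pt}
    (hf : ∀ w, ∀ x ∈ s, IsBarycentric N T w x → f x = ∑ p ∈ T, w p • g p) :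
    ∃ C, LipschitzOnWith C f (hull N T ∩ s) := by
  have hsmooth : ContDiff ℝ 1 fun x => ∑ p : T, hT.affineBasis.coord p x • g p :=
    ContDiff.sum fun p _ =>
      ((smooth_barycentric_coord hT.affineBasis p).of_le le_top).smul contDiff_const
  obtain ⟨C, hC⟩ := hsmooth.locallyLipschitz.locallyLipschitzOn.exists_lipschitzOnWith_of_compact
    (isCompact_hull N T)
  have hval : ∀ x ∈ hull N T ∩ s, f x = ∑ p : T, hT.affineBasis.coord p x • g p := by
    rintro x ⟨hx, hxs⟩
    obtain ⟨w, hw⟩ := (mem_hull_iff hN).1 hx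
    simp only [hf w x hxs hw, hT.coord_eq hw]
    exact (Finset.sum_coe_sort T fun p => w p • g p).symm
  exact ⟨C, fun x hx y hy => by rw [hval x hx, hval y hy]; exact hC hx.1 hy.1⟩

open Classical in
theorem sum_indicator_smul {V : Type*} [AddCommGroup V] [Module ℝ V] {S U : Finset LPt}
    (hUS : U ⊆ S) (u : LPt → ℝ) (g : LPt → V) :
    ∑ p ∈ S, (if p ∈ U then u p else 0) • g p = ∑ p ∈ U, u p • g p := by
  simp only [ite_smul, zero_smul]
  rw [← Finset.sum_filter, Finset.filter_mem_eq_inter, Finset.inter_eq_right.2 hUS]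

theorem IsTetrahedron.sum_smul_eq_of_subset {N : ℕ} {S U : Finset LPt} (hS : IsTetrahedron N S)
    (hUS : U ⊆ S) {w u : LPt → ℝ} {x : Pt} (hw : IsBarycentric N S w x)
    (hu : IsBarycentric N U u x) (f : LPt → Pt) :
    ∑ p ∈ S, w p • f p = ∑ p ∈ U, u p • f p := by
  classical
  have hext : IsBarycentric N S (fun p => if p ∈ U then u p else 0) x := by
    refine ⟨fun p _ => ?_, ?_, (sum_indicator_smul hUS u _).trans hu.2.2⟩
    · dsimp only
      split_ifs with hp
      exacts [hu.1 p hp, le_rfl]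
    · simpa [hu.2.1] using sum_indicator_smul hUS u fun _ => (1 : ℝ)
  rw [← sum_indicator_smul hUS]
  exact Finset.sum_congr rfl fun p hp => by rw [hS.weights_eq hw hext p hp]

/-- Linear interpolation of lattice values gives, at every common point, the same result on the
simplices of `𝒮` as on those of `𝒯`. For `𝒮 = 𝒯` this makes the interpolant well defined, for
different sets it makes the interpolants match. -/
def Agree (N : ℕ) (𝒮 𝒯 : Set (Finset LPt)) : Prop :=
  ∀ S ∈ 𝒮, ∀ T ∈ 𝒯, ∀ w w' x, IsBarycentric N S w x → IsBarycentric N T w' x →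
    ∀ f : LPt → Pt, ∑ p ∈ S, w p • f p = ∑ p ∈ T, w' p • f p

theorem Agree.symm {N : ℕ} {𝒮 𝒯 : Set (Finset LPt)} (h : Agree N 𝒮 𝒯) : Agree N 𝒯 𝒮 :=
  fun T hT S hS w w' x hw hw' f => (h S hS T hT w' w x hw' hw f).symm

theorem Conforming.agree {N : ℕ} (hN : 0 < N) {𝒮 𝒯 : Set (Finset LPt)} (h : Conforming N 𝒮 𝒯)
    (h𝒮 : ∀ S ∈ 𝒮, IsTetrahedron N S) (h𝒯 : ∀ T ∈ 𝒯, IsTetrahedron N T) : Agree N 𝒮 𝒯 := by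
  intro S hS T hT w w' x hw hw' f
  have hx : x ∈ hull N (S ∩ T) :=
    h S hS T hT ▸ ⟨(mem_hull_iff hN).2 ⟨w, hw⟩, (mem_hull_iff hN).2 ⟨w', hw'⟩⟩
  obtain ⟨u, hu⟩ := (mem_hull_iff hN).1 hx
  rw [(h𝒮 S hS).sum_smul_eq_of_subset Finset.inter_subset_left hw hu f,
    (h𝒯 T hT).sum_smul_eq_of_subset Finset.inter_subset_right hw' hu f]

theorem exists_interpolant_eq {N : ℕ} (hN : 0 < N) {𝒯 : Finset (Finset LPt)} {x : Pt}
    (hx : ∃ T ∈ 𝒯, x ∈ hull N T) : ∃ T ∈ 𝒯, ∃ w, IsBarycentric N T w x ∧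
      ∀ y, interpolant N 𝒯 y x = ∑ p ∈ T, w p • y (latticePt N p) := by
  obtain ⟨T, hT, hxT⟩ := hx
  obtain ⟨w, hw⟩ := (mem_hull_iff hN).1 hxT
  have hex : ∃ q : Finset LPt × (LPt → ℝ), q.1 ∈ 𝒯 ∧ IsBarycentric N q.1 q.2 x :=
    ⟨(T, w), hT, hw⟩
  exact ⟨_, hex.choose_spec.1, _, hex.choose_spec.2, fun y => dif_pos hex⟩

theorem interpolant_eq {N : ℕ} (hN : 0 < N) {𝒯 : Finset (Finset LPt)} (h : Agree N 𝒯 𝒯)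
    {T : Finset LPt} (hT : T ∈ 𝒯) {w : LPt → ℝ} {x : Pt} (hw : IsBarycentric N T w x)
    (y : Pt → Pt) : interpolant N 𝒯 y x = ∑ p ∈ T, w p • y (latticePt N p) := by
  obtain ⟨T', hT', w', hw', hval⟩ :=
    exists_interpolant_eq hN ⟨T, hT, (mem_hull_iff hN).2 ⟨w, hw⟩⟩
  rw [hval]
  exact h T' hT' T hT w' w x hw' hw fun p => y (latticePt N p)

theorem interpolant_mulVec_add {N : ℕ} (hN : 0 < N) {𝒯 : Finset (Finset LPt)} {x : Pt}
    (hx : ∃ T ∈ 𝒯, x ∈ hull N T) (F : Matrix (Fin 3) (Fin 3) ℝ) (t : ℝ) (v : Pt → Pt) :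
    interpolant N 𝒯 (fun x => F.mulVec x + t • v x) x = F.mulVec x + t • interpolant N 𝒯 v x := by
  obtain ⟨T, -, w, hw, hval⟩ := exists_interpolant_eq hN hx
  have hF : ∑ p ∈ T, w p • F.mulVec (latticePt N p) = F.mulVec x := by
    rw [← hw.2.2, ← Matrix.mulVecLin_apply, map_sum]
    simp
  simp only [hval, smul_add, Finset.sum_add_distrib, hF, Finset.smul_sum, smul_comm t]

/-- The coordinates of `x` in the box with main diagonal from `x_ℓ` to `x_{ℓ+η}`, scaled to the unit
cube. -/
def relCoord (N : ℕ) (η l : LPt) (x : Pt) : Pt :=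
  fun i => (x i / spacing N - l i) / η i

theorem continuous_relCoord (N : ℕ) (η l : LPt) : Continuous (relCoord N η l) := by
  unfold relCoord; fun_prop

theorem apply_eq_add_mul_relCoord {N : ℕ} (hN : 0 < N) {η : LPt} (hη : ∀ i, η i ≠ 0) (l : LPt)
    (x : Pt) (i : Fin 3) :
    x i = latticePt N l i + spacing N * η i * relCoord N η l x i := by
  have hε := (spacing_pos hN).ne'
  have hηi : (η i : ℝ) ≠ 0 := Int.cast_ne_zero.2 (hη i)
  simp only [relCoord, latticePt]
  field_simp
  ring

theorem relCoord_add_mul {N : ℕ} {η : LPt} (hη : ∀ i, η i ≠ 0) (l m : LPt) (x : Pt) (i : Fin 3) :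
    relCoord N η (l + η * m) x i = relCoord N η l x i - m i := by
  have hηi : (η i : ℝ) ≠ 0 := Int.cast_ne_zero.2 (hη i)
  simp only [relCoord, Pi.add_apply, Pi.mul_apply]
  push_cast
  field_simp
  ring

theorem add_mul_mem_uIcc_iff {a d t : ℝ} (hd : d ≠ 0) :
    a + d * t ∈ uIcc a (a + d) ↔ t ∈ Icc 0 1 := by
  rcases hd.lt_or_gt with hd | hd
  · rw [uIcc_of_ge (by linarith)]
    constructor <;> rintro ⟨h₀, h₁⟩ <;> constructor <;> nlinarith
  · rw [uIcc_of_le (by linarith)]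
    constructor <;> rintro ⟨h₀, h₁⟩ <;> constructor <;> nlinarith

theorem add_mul_mem_uIoo_iff {a d t : ℝ} (hd : d ≠ 0) :
    a + d * t ∈ uIoo a (a + d) ↔ t ∈ Ioo 0 1 := by
  rcases hd.lt_or_gt with hd | hd
  · rw [uIoo_of_ge (by linarith)]
    constructor <;> rintro ⟨h₀, h₁⟩ <;> constructor <;> nlinarith
  · rw [uIoo_of_le (by linarith)]
    constructor <;> rintro ⟨h₀, h₁⟩ <;> constructor <;> nlinarith

theorem bondVolume_eq_pi (N : ℕ) (η l : LPt) :
    bondVolume N η l = univ.pi fun i => uIoo (latticePt N l i) (latticePt N (l + η) i) := by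
  ext x
  simp [bondVolume, uIoo]

theorem isOpen_bondVolume (N : ℕ) (η l : LPt) : IsOpen (bondVolume N η l) := by
  rw [bondVolume_eq_pi]
  exact isOpen_set_pi finite_univ fun i _ => isOpen_Ioo

theorem convex_bondVolume (N : ℕ) (η l : LPt) : Convex ℝ (bondVolume N η l) := by
  rw [bondVolume_eq_pi]
  exact convex_pi fun i _ => convex_Ioo _ _

theorem spacing_mul_ne_zero {N : ℕ} (hN : 0 < N) {η : LPt} (hη : ∀ i, η i ≠ 0) (i : Fin 3) :
    spacing N * η i ≠ 0 :=
  mul_ne_zero (spacing_pos hN).ne' (Int.cast_ne_zero.2 (hη i))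

theorem mem_bondVolume_iff {N : ℕ} (hN : 0 < N) {η : LPt} (hη : ∀ i, η i ≠ 0) {l : LPt} {x : Pt} :
    x ∈ bondVolume N η l ↔ ∀ i, relCoord N η l x i ∈ Ioo 0 1 := by
  rw [bondVolume_eq_pi, mem_univ_pi]
  refine forall_congr' fun i => ?_
  rw [apply_eq_add_mul_relCoord hN hη l x i, latticePt_add, Pi.add_apply, Pi.smul_apply,
    smul_eq_mul]
  exact add_mul_mem_uIoo_iff (spacing_mul_ne_zero hN hη i)

theorem closure_bondVolume {N : ℕ} (hN : 0 < N) {η : LPt} (hη : ∀ i, η i ≠ 0) (l : LPt) :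
    closure (bondVolume N η l) =
      univ.pi fun i => uIcc (latticePt N l i) (latticePt N (l + η) i) := by
  rw [bondVolume_eq_pi, closure_pi_set]
  refine congrArg _ (funext fun i => closure_uIoo ?_)
  rw [latticePt_add]
  simpa [toVec] using ⟨(spacing_pos hN).ne', hη i⟩

theorem mem_closure_bondVolume_iff {N : ℕ} (hN : 0 < N) {η : LPt} (hη : ∀ i, η i ≠ 0) {l : LPt}
    {x : Pt} : x ∈ closure (bondVolume N η l) ↔ ∀ i, relCoord N η l x i ∈ Icc 0 1 := by
  rw [closure_bondVolume hN hη, mem_univ_pi]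
  refine forall_congr' fun i => ?_
  rw [apply_eq_add_mul_relCoord hN hη l x i, latticePt_add, Pi.add_apply, Pi.smul_apply,
    smul_eq_mul]
  exact add_mul_mem_uIcc_iff (spacing_mul_ne_zero hN hη i)

theorem pathVertex_injective {η : LPt} (hη : ∀ i, η i ≠ 0) (l : LPt) (σ : Equiv.Perm (Fin 3)) :
    Function.Injective (pathVertex l η σ) := by
  intro j k h
  by_contra hne
  wlog hjk : j < k generalizing j k
  · exact this h.symm (Ne.symm hne) ((not_lt.1 hjk).lt_of_ne (Ne.symm hne))
  have hjk' : (j : ℕ) < k := hjk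
  have hi := congrFun h (σ.symm ⟨j, by omega⟩)
  simp only [pathVertex, Equiv.apply_symm_apply, lt_self_iff_false, ↓reduceIte, add_zero, hjk',
    left_eq_add] at hi
  exact hη _ hi

theorem sum_pathVertex {η : LPt} (hη : ∀ i, η i ≠ 0) (l : LPt) (σ : Equiv.Perm (Fin 3))
    {V : Type*} [AddCommMonoid V] (g : LPt → V) :
    ∑ p ∈ Finset.univ.image (pathVertex l η σ), g p = ∑ j, g (pathVertex l η σ j) :=
  Finset.sum_image (pathVertex_injective hη l σ).injOn

theorem sum_smul_pathVertex_apply (N : ℕ) (η l : LPt) (σ : Equiv.Perm (Fin 3)) (u : Fin 4 → ℝ)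
    (i : Fin 3) :
    (∑ j, u j • latticePt N (pathVertex l η σ j)) i = (∑ j, u j) * latticePt N l i +
      spacing N * η i * ∑ j : Fin 4, if (σ i : ℕ) < j then u j else 0 := by
  simp only [Finset.sum_apply, Pi.smul_apply, smul_eq_mul, latticePt, pathVertex, Finset.mul_sum,
    Finset.sum_mul, ← Finset.sum_add_distrib]
  refine Finset.sum_congr rfl fun j _ => ?_
  split_ifs <;> push_cast <;> ring

theorem isBarycentric_path_iff {N : ℕ} (hN : 0 < N) {η : LPt} (hη : ∀ i, η i ≠ 0) {l : LPt}
    {σ : Equiv.Perm (Fin 3)} {w : LPt → ℝ} {x : Pt} :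
    IsBarycentric N (Finset.univ.image (pathVertex l η σ)) w x ↔
      (∀ j, 0 ≤ w (pathVertex l η σ j)) ∧ ∑ j, w (pathVertex l η σ j) = 1 ∧
      ∀ i, relCoord N η l x i =
        ∑ j : Fin 4, if (σ i : ℕ) < j then w (pathVertex l η σ j) else 0 := by
  unfold IsBarycentric
  rw [sum_pathVertex hη, sum_pathVertex hη, Finset.forall_mem_image]
  simp only [Finset.mem_univ, forall_const]
  refine and_congr_right fun _ => and_congr_right fun h1 => funext_iff.trans ?_
  refine forall_congr' fun i => ?_
  rw [sum_smul_pathVertex_apply, h1, one_mul, apply_eq_add_mul_relCoord hN hη l x i,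
    add_right_inj, mul_right_inj' (spacing_mul_ne_zero hN hη i), eq_comm]

theorem affineIndependent_pathVertex {N : ℕ} (hN : 0 < N) {η : LPt} (hη : ∀ i, η i ≠ 0) (l : LPt)
    (σ : Equiv.Perm (Fin 3)) : AffineIndependent ℝ fun j => latticePt N (pathVertex l η σ j) := by
  rw [affineIndependent_iff_of_fintype]
  intro u hu hux
  rw [Finset.weightedVSub_eq_linear_combination _ hu] at hux
  have hpartial : ∀ k, ∑ j : Fin 4, (if (k : Fin 3).val < j then u j else 0) = 0 := fun k => by
    have h := congrFun hux (σ.symm k)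
    rw [sum_smul_pathVertex_apply, hu, zero_mul, zero_add, Pi.zero_apply,
      Equiv.apply_symm_apply] at h
    exact (mul_eq_zero.1 h).resolve_left (spacing_mul_ne_zero hN hη _)
  have h0 : u 1 + u 2 + u 3 = 0 := by simpa [Fin.sum_univ_four] using hpartial 0
  have h1 : u 2 + u 3 = 0 := by simpa [Fin.sum_univ_four] using hpartial 1
  have h2 : u 3 = 0 := by simpa [Fin.sum_univ_four] using hpartial 2
  rw [Fin.sum_univ_four] at hu
  intro j
  fin_cases j <;> simp <;> linarith

theorem isTetrahedron_of_mem_typeA {N : ℕ} (hN : 0 < N) {η : LPt} (hη : ∀ i, η i ≠ 0) {l : LPt}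
    {T : Finset LPt} (hT : T ∈ typeA l η) : IsTetrahedron N T := by
  obtain ⟨σ, -, rfl⟩ := Finset.mem_image.1 hT
  refine ⟨by simp [Finset.card_image_of_injective _ (pathVertex_injective hη l σ)], ?_⟩
  have hrange := (affineIndependent_pathVertex hN hη l σ).range
  have himage : range (fun j => latticePt N (pathVertex l η σ j)) =
      range fun p : (Finset.univ.image (pathVertex l η σ) : Finset LPt) => latticePt N p := by
    ext x
    simp
  rw [himage] at hrange
  exact AffineIndependent.of_set_of_injective hrange
    ((latticePt_injective hN).comp Subtype.val_injective)

theorem relCoord_pathVertex {N : ℕ} (hN : 0 < N) {η : LPt} (hη : ∀ i, η i ≠ 0) (l : LPt)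
    (σ : Equiv.Perm (Fin 3)) (j : Fin 4) (i : Fin 3) :
    relCoord N η l (latticePt N (pathVertex l η σ j)) i = if (σ i : ℕ) < j then 1 else 0 := by
  have hε := (spacing_pos hN).ne'
  have hηi : (η i : ℝ) ≠ 0 := Int.cast_ne_zero.2 (hη i)
  simp only [relCoord, latticePt, pathVertex]
  split_ifs <;> push_cast <;> field_simp <;> ring

theorem hull_subset_closure_bondVolume {N : ℕ} (hN : 0 < N) {η : LPt} (hη : ∀ i, η i ≠ 0)
    {l : LPt} {T : Finset LPt} (hT : T ∈ typeA l η) : hull N T ⊆ closure (bondVolume N η l) := by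
  obtain ⟨σ, -, rfl⟩ := Finset.mem_image.1 hT
  refine convexHull_min ?_ (convex_bondVolume N η l).closure
  rintro _ ⟨p, hp, rfl⟩
  obtain ⟨j, -, rfl⟩ := Finset.mem_image.1 (Finset.mem_coe.1 hp)
  refine (mem_closure_bondVolume_iff hN hη).2 fun i => ?_
  rw [relCoord_pathVertex hN hη]
  split_ifs <;> simp

theorem exists_typeA_mem_hull {N : ℕ} (hN : 0 < N) {η : LPt} (hη : ∀ i, η i ≠ 0) {l : LPt}
    {x : Pt} (hx : x ∈ closure (bondVolume N η l)) : ∃ T ∈ typeA l η, x ∈ hull N T := by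
  rw [mem_closure_bondVolume_iff hN hη] at hx
  set t := relCoord N η l x
  -- Switching the coordinates in decreasing order of `t` makes the weights differences of
  -- consecutive values of `t`.
  set ρ := Tuple.sort fun i => -t i
  have hmono : Antitone (t ∘ ρ) := fun i j hij =>
    neg_le_neg_iff.1 (Tuple.monotone_sort (fun i => -t i) hij)
  have h01 : t (ρ 1) ≤ t (ρ 0) := hmono (by decide)
  have h12 : t (ρ 2) ≤ t (ρ 1) := hmono (by decide)
  set u : Fin 4 → ℝ := ![1 - t (ρ 0), t (ρ 0) - t (ρ 1), t (ρ 1) - t (ρ 2), t (ρ 2)] with hu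
  refine ⟨_, Finset.mem_image_of_mem _ (Finset.mem_univ ρ.symm), (mem_hull_iff hN).2
    ⟨fun p => u (Function.invFun (pathVertex l η ρ.symm) p), ?_⟩⟩
  rw [isBarycentric_path_iff hN hη]
  simp only [Function.leftInverse_invFun (pathVertex_injective hη l ρ.symm) _]
  refine ⟨fun j => ?_, by simp [hu, Fin.sum_univ_four], fun i => ?_⟩
  · fin_cases j <;> simp [hu] <;> linarith [(hx (ρ 0)).2, (hx (ρ 2)).1]
  · obtain ⟨k, rfl⟩ := ρ.surjective i
    rw [Equiv.symm_apply_apply]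
    fin_cases k <;> simp [hu, Fin.sum_univ_four, t]

theorem integral_eq_smul_of_eq_on_Ioo {E : Type*} [NormedAddCommGroup E] [NormedSpace ℝ E]
    [CompleteSpace E] {a b : ℝ} (hab : a ≤ b) {g : ℝ → E} {c : E} (h : ∀ s ∈ Ioo a b, g s = c) :
    IntervalIntegrable g volume a b ∧ ∫ s in a..b, g s = (b - a) • c := by
  have hae : (fun _ => c) =ᵐ[volume.restrict (Ioc a b)] g := by
    rw [← Measure.restrict_congr_set Ioo_ae_eq_Ioc, EventuallyEq,
      ae_restrict_iff' measurableSet_Ioo]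
    exact Eventually.of_forall fun s hs => (h s hs).symm
  refine ⟨(intervalIntegrable_iff_integrableOn_Ioc_of_le hab).2
    ((integrableOn_const (by simp)).congr hae), ?_⟩
  rw [intervalIntegral.integral_of_le hab, ← integral_congr_ae hae]
  simp [Real.volume_real_Ioc_of_le hab]

theorem integral_eq_sum_smul_of_eq_on_Ioo {E : Type*} [NormedAddCommGroup E] [NormedSpace ℝ E]
    [CompleteSpace E] {W : ℕ → ℝ} (hW : Monotone W) {n : ℕ} {g : ℝ → E} {c : ℕ → E}
    (h : ∀ k < n, ∀ s ∈ Ioo (W k) (W (k + 1)), g s = c k) :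
    ∫ s in W 0..W n, g s = ∑ k ∈ Finset.range n, (W (k + 1) - W k) • c k := by
  have hpiece := fun k (hk : k < n) => integral_eq_smul_of_eq_on_Ioo (hW k.le_succ) (h k hk)
  rw [← intervalIntegral.sum_integral_adjacent_intervals fun k hk => (hpiece k hk).1]
  exact Finset.sum_congr rfl fun k hk => (hpiece k (Finset.mem_range.1 hk)).2

/-- The average over `s ∈ [0, 1]` of the lattice function `f` at the corner of the tiling by the
boxes `B_{ℓ+ηm,η}` obtained by rounding down the relative coordinates of `x`, shifted by `s`. It
gives a formula for type A interpolation which does not refer to any tetrahedron or box. -/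
def floorAverage (N : ℕ) (η l : LPt) (f : LPt → Pt) (x : Pt) : Pt :=
  ∫ s in (0 : ℝ)..1, f fun i => l i + η i * ⌊relCoord N η l x i + s⌋

theorem floorAverage_add_mul {N : ℕ} {η : LPt} (hη : ∀ i, η i ≠ 0) (l m : LPt) (f : LPt → Pt)
    (x : Pt) : floorAverage N η (l + η * m) f x = floorAverage N η l f x := by
  simp only [floorAverage, relCoord_add_mul hη, sub_add_eq_add_sub, Int.floor_sub_intCast,
    Pi.add_apply, Pi.mul_apply]
  refine intervalIntegral.integral_congr fun s _ => congrArg f (funext fun i => ?_)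
  ring

theorem floorAverage_eq {N : ℕ} (hN : 0 < N) {η : LPt} (hη : ∀ i, η i ≠ 0) {l : LPt}
    {T : Finset LPt} (hT : T ∈ typeA l η) {w : LPt → ℝ} {x : Pt} (hw : IsBarycentric N T w x)
    (f : LPt → Pt) : floorAverage N η l f x = ∑ p ∈ T, w p • f p := by
  obtain ⟨σ, -, rfl⟩ := Finset.mem_image.1 hT
  obtain ⟨h0, h1, hx⟩ := (isBarycentric_path_iff hN hη).1 hw
  set u : Fin 4 → ℝ := fun j => w (pathVertex l η σ j)
  -- For `s` between `W k = ∑ j < k, u j` and `W (k + 1)` the rounded point is the vertex `k` of the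
  -- path.
  set W : ℕ → ℝ := fun k => ∑ j : Fin 4, if (j : ℕ) < k then u j else 0
  have hWmono : Monotone W := fun a b hab => Finset.sum_le_sum fun j _ => by
    have := h0 j
    split_ifs <;> first | omega | simp_all
  have hW0 : W 0 = 0 := by simp [W]
  have hW4 : W 4 = 1 := by simpa [W] using h1
  have hcoord : ∀ i, relCoord N η l x i = 1 - W (σ i + 1) := fun i => by
    rw [hx, ← h1, eq_sub_iff_add_eq, ← Finset.sum_add_distrib]
    refine Finset.sum_congr rfl fun j _ => ?_
    split_ifs <;> first | omega | simp [u]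
  have hfloor : ∀ k < 4, ∀ s ∈ Ioo (W k) (W (k + 1)), ∀ i,
      ⌊relCoord N η l x i + s⌋ = if (σ i : ℕ) < k then 1 else 0 := fun k hk s hs i => by
    have hs0 : 0 < s := (hW0 ▸ hWmono k.zero_le).trans_lt hs.1
    have hs1 : s < 1 := hs.2.trans_le (hW4 ▸ hWmono (Nat.succ_le_of_lt hk))
    have hWi0 : 0 ≤ W (σ i + 1) := hW0 ▸ hWmono (Nat.zero_le _)
    have hWi1 : W (σ i + 1) ≤ 1 := hW4 ▸ hWmono (by omega)
    rw [hcoord, Int.floor_eq_iff]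
    split_ifs with hi
    · have := hWmono (Nat.succ_le_of_lt hi)
      constructor <;> push_cast <;> linarith [hs.1]
    · have := hWmono (Nat.succ_le_succ (not_lt.1 hi))
      constructor <;> push_cast <;> linarith [hs.2]
  have hint := integral_eq_sum_smul_of_eq_on_Ioo hWmono (n := 4)
    (g := fun s => f fun i => l i + η i * ⌊relCoord N η l x i + s⌋)
    (c := fun k => f fun i => l i + if (σ i : ℕ) < k then η i else 0) fun k hk s hs => by
      simp only [hfloor k hk s hs, mul_ite, mul_one, mul_zero]
  rw [floorAverage, sum_pathVertex hη, ← hW0, ← hW4, hint, Finset.sum_range]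
  refine Finset.sum_congr rfl fun j _ => congrArg (· • _) ?_
  fin_cases j <;> simp [W, u, Fin.sum_univ_four]

theorem agree_typeA {N : ℕ} (hN : 0 < N) {η : LPt} (hη : ∀ i, η i ≠ 0) (l m : LPt) :
    Agree N (typeA l η) (typeA (l + η * m) η) := by
  intro S hS T hT w w' x hw hw' f
  rw [← floorAverage_eq hN hη hS hw, ← floorAverage_eq hN hη hT hw', floorAverage_add_mul hη]

theorem agree_typeA_self {N : ℕ} (hN : 0 < N) {η : LPt} (hη : ∀ i, η i ≠ 0) (l : LPt) :
    Agree N (typeA l η) (typeA l η) := by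
  simpa using agree_typeA hN hη l 0

theorem agree_latticeTets {N : ℕ} (hN : 0 < N) (U U' : Set Pt) :
    Agree N (latticeTets N U) (latticeTets N U') := by
  rintro S ⟨⟨l, hS⟩, -⟩ T ⟨⟨l', hT⟩, -⟩
  have h := agree_typeA hN (η := 1) (fun _ => one_ne_zero) l (l' - l)
  rw [one_mul, add_sub_cancel] at h
  exact h S hS T hT

theorem eq_of_positive_weights_of_mem_hull {N : ℕ} (hN : 0 < N) {U U' : Set Pt}
    {S T : Finset LPt} (hS : S ∈ latticeTets N U) (hT : T ∈ latticeTets N U') {w : LPt → ℝ}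
    {x : Pt} (hw : IsBarycentric N S w x) (hpos : ∀ p ∈ S, 0 < w p) (hx : x ∈ hull N T) :
    S = T := by
  classical
  have hcard : ∀ {l : LPt} {T : Finset LPt}, T ∈ typeA l 1 → T.card = 4 :=
    fun hT => (isTetrahedron_of_mem_typeA hN (fun _ => one_ne_zero) hT).1
  obtain ⟨w', hw'⟩ := (mem_hull_iff hN).1 hx
  refine Finset.eq_of_subset_of_card_le (fun p hp => ?_)
    ((hcard hT.1.choose_spec).trans (hcard hS.1.choose_spec).symm).le
  by_contra hpT
  have hvalue := agree_latticeTets hN U U' S hS T hT w w' x hw hw' (Pi.single p 1)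
  rw [Finset.sum_eq_single_of_mem p hp fun q _ hq => by rw [Pi.single_eq_of_ne hq, smul_zero],
    Finset.sum_eq_zero fun q hq => by
      rw [Pi.single_eq_of_ne (ne_of_mem_of_not_mem hq hpT), smul_zero], Pi.single_eq_same] at hvalue
  exact (hpos p hp).ne' (by simpa using congrFun hvalue 0)

theorem exists_int_cell_mem {a b : ℤ} (hab : a ≠ b) {z : ℝ} (hz : z ∈ uIcc (a : ℝ) b) :
    ∃ m : ℤ, (m : ℝ) ∈ uIcc (a : ℝ) b ∧ (m + 1 : ℝ) ∈ uIcc (a : ℝ) b ∧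
      z ∈ Icc (m : ℝ) (m + 1) := by
  wlog h : a < b generalizing a b
  · simpa only [uIcc_comm] using this hab.symm (uIcc_comm (a : ℝ) b ▸ hz)
      (hab.lt_or_gt.resolve_left h)
  have hab' : (a : ℝ) ≤ b := Int.cast_le.2 h.le
  rw [uIcc_of_le hab'] at hz ⊢
  have ha : a ≤ ⌊z⌋ := Int.le_floor.2 hz.1
  rcases lt_or_ge ⌊z⌋ b with hb | hb
  · refine ⟨⌊z⌋, ?_, ?_, Int.floor_le z, (Int.lt_floor_add_one z).le⟩ <;>
      constructor <;> norm_cast <;> omega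
  · have hzb : z = b := le_antisymm hz.2 ((Int.cast_le.2 hb).trans (Int.floor_le z))
    refine ⟨b - 1, ?_, ?_, ?_⟩ <;> push_cast
    · exact ⟨by exact_mod_cast Int.le_sub_one_of_lt h, by linarith⟩
    · exact ⟨by linarith, by linarith⟩
    · exact ⟨by linarith, by linarith⟩

theorem mul_mem_uIcc_mul_iff {c a b t : ℝ} (hc : c ≠ 0) :
    c * t ∈ uIcc (c * a) (c * b) ↔ t ∈ uIcc a b := by
  rw [← image_const_mul_uIcc, (mul_right_injective₀ hc).mem_set_image]

theorem exists_cell_subset_closure_bondVolume {N : ℕ} (hN : 0 < N) {η : LPt} (hη : ∀ i, η i ≠ 0)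
    {l : LPt} {x : Pt} (hx : x ∈ closure (bondVolume N η l)) :
    ∃ m, x ∈ closure (bondVolume N 1 m) ∧
      closure (bondVolume N 1 m) ⊆ closure (bondVolume N η l) := by
  have hε := (spacing_pos hN).ne'
  simp only [closure_bondVolume hN hη, closure_bondVolume hN (η := 1) fun _ => one_ne_zero,
    mem_univ_pi] at hx ⊢
  have hcell : ∀ i, ∃ m : ℤ, (m : ℝ) ∈ uIcc (l i : ℝ) ((l i + η i : ℤ) : ℝ) ∧
      (m + 1 : ℝ) ∈ uIcc (l i : ℝ) ((l i + η i : ℤ) : ℝ) ∧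
      x i / spacing N ∈ Icc (m : ℝ) (m + 1) := fun i =>
    exists_int_cell_mem (by simpa using hη i) <| by
      rw [← mul_mem_uIcc_mul_iff hε, mul_div_cancel₀ _ hε]
      exact hx i
  choose m hm hm' hxm using hcell
  refine ⟨m, fun i => ?_, pi_mono fun i _ => uIcc_subset_uIcc ?_ ?_⟩ <;>
    simp only [latticePt, Pi.add_apply, Pi.one_apply]
  · rw [← mul_div_cancel₀ (x i) hε, mul_mem_uIcc_mul_iff hε, Int.cast_add, Int.cast_one,
      uIcc_of_le (by linarith)]
    exact hxm i
  · exact (mul_mem_uIcc_mul_iff hε).2 (hm i)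
  · exact (mul_mem_uIcc_mul_iff hε).2 (by exact_mod_cast hm' i)

theorem exists_latticeTet_mem_hull {N : ℕ} (hN : 0 < N) {η : LPt} (hη : ∀ i, η i ≠ 0) {l : LPt}
    {x : Pt} (hx : x ∈ closure (bondVolume N η l)) :
    ∃ T ∈ latticeTets N (bondVolume N η l), x ∈ hull N T := by
  obtain ⟨m, hxm, hm⟩ := exists_cell_subset_closure_bondVolume hN hη hx
  obtain ⟨T, hT, hxT⟩ := exists_typeA_mem_hull hN (η := 1) (fun _ => one_ne_zero) hxm
  exact ⟨T, ⟨⟨m, hT⟩,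
    (hull_subset_closure_bondVolume hN (fun _ => one_ne_zero) hT).trans hm⟩, hxT⟩

open Classical in
/-- The weights obtained from `w` by moving the mass `δ` from the vertex `p` to the vertex `q`. -/
def moveWeight (w : LPt → ℝ) (p q : LPt) (δ : ℝ) : LPt → ℝ :=
  fun r => w r + (Pi.single q δ : LPt → ℝ) r - (Pi.single p δ : LPt → ℝ) r

theorem sum_moveWeight_smul {V : Type*} [AddCommGroup V] [Module ℝ V] {T : Finset LPt}
    {p q : LPt} (hp : p ∈ T) (hq : q ∈ T) (w : LPt → ℝ) (δ : ℝ) (g : LPt → V) :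
    ∑ r ∈ T, moveWeight w p q δ r • g r = ∑ r ∈ T, w r • g r + δ • (g q - g p) := by
  classical
  simp only [moveWeight, sub_smul, add_smul, Finset.sum_sub_distrib, Finset.sum_add_distrib,
    Pi.single_apply, ite_smul, zero_smul, Finset.sum_ite_eq', hp, hq, if_true, smul_sub]
  abel

theorem IsBarycentric.moveWeight {N : ℕ} {T : Finset LPt} {w : LPt → ℝ} {x : Pt}
    (hw : IsBarycentric N T w x) {p q : LPt} (hp : p ∈ T) (hq : q ∈ T) {δ : ℝ}
    (hpδ : δ ≤ w p) (hqδ : -δ ≤ w q) :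
    IsBarycentric N T (moveWeight w p q δ) (x + δ • (latticePt N q - latticePt N p)) := by
  refine ⟨fun r hr => ?_, ?_, ?_⟩
  · have := hw.1 r hr
    simp only [ACCoupling.moveWeight, Pi.single_apply]
    split_ifs with hrq hrp hrp <;> subst_vars <;> linarith
  · simpa [hw.2.1] using sum_moveWeight_smul hp hq w δ fun _ => (1 : ℝ)
  · rw [sum_moveWeight_smul hp hq, hw.2.2]

theorem interpolant_typeA_add_smul {N : ℕ} (hN : 0 < N) {η : LPt} (hη : ∀ i, η i ≠ 0) {l : LPt}
    {x : Pt} (hx : x ∈ bondVolume N η l) (y : Pt → Pt) :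
    ∀ᶠ s : ℝ in 𝓝 0, interpolant N (typeA l η) y (x + s • toVec η) =
      interpolant N (typeA l η) y x + s • diffQuot N η y l := by
  have hε := (spacing_pos hN).ne'
  obtain ⟨T, hT, hxT⟩ := exists_typeA_mem_hull hN hη (subset_closure hx)
  obtain ⟨w, hw⟩ := (mem_hull_iff hN).1 hxT
  have hends : l ∈ T ∧ l + η ∈ T ∧ 0 < w l ∧ 0 < w (l + η) := by
    obtain ⟨σ, -, rfl⟩ := Finset.mem_image.1 hT
    have hstart : pathVertex l η σ 0 = l := funext fun i => by simp [pathVertex]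
    have hend : pathVertex l η σ 3 = l + η := funext fun i => by simp [pathVertex]
    obtain ⟨-, hsum, hrel⟩ := (isBarycentric_path_iff hN hη).1 hw
    rw [mem_bondVolume_iff hN hη] at hx
    refine ⟨Finset.mem_image.2 ⟨0, Finset.mem_univ _, hstart⟩,
      Finset.mem_image.2 ⟨3, Finset.mem_univ _, hend⟩, ?_, ?_⟩
    · have hlast :
          w (pathVertex l η σ 1) + w (pathVertex l η σ 2) + w (pathVertex l η σ 3) < 1 := by
        simpa [hrel, Fin.sum_univ_four] using (hx (σ.symm 0)).2
      rw [Fin.sum_univ_four, hstart] at hsum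
      linarith
    · simpa [hrel, Fin.sum_univ_four, hend] using (hx (σ.symm 2)).1
  obtain ⟨hp, hq, hwp, hwq⟩ := hends
  have hsmall : Tendsto (fun s : ℝ => s / spacing N) (𝓝 0) (𝓝 0) := by
    simpa using (tendsto_id (α := ℝ) (x := 𝓝 0)).div_const (spacing N)
  filter_upwards [hsmall.eventually_le_const hwp, hsmall.eventually_const_le (neg_lt_zero.2 hwq)]
    with s hsp hsq
  have hmove := hw.moveWeight hp hq hsp (neg_le.1 hsq)
  have hshift : (s / spacing N) • (latticePt N (l + η) - latticePt N l) = s • toVec η := by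
    rw [latticePt_add, add_sub_cancel_left, smul_smul, div_mul_cancel₀ _ hε]
  rw [hshift] at hmove
  have hself := agree_typeA_self hN hη l
  rw [interpolant_eq hN hself hT hw, interpolant_eq hN hself hT hmove,
    sum_moveWeight_smul hp hq, diffQuot, smul_smul, div_eq_mul_inv]

/-! ### Regions and meshes -/

theorem IsLatticeRegion.isOpen {N : ℕ} {M : Fin 3 → ℕ} {U : Set Pt} (h : IsLatticeRegion N M U) :
    IsOpen U := by
  obtain ⟨⟨𝒮, -, rfl⟩, -⟩ := h
  exact isOpen_interior

theorem domain_eq_Icc (M : Fin 3 → ℕ) :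
    domain M = Icc (fun i => -(M i : ℝ) + 1) (fun i => (M i : ℝ)) := by
  ext x
  simp [domain, Pi.le_def, forall_and]

theorem isCompact_domain (M : Fin 3 → ℕ) : IsCompact (domain M) :=
  domain_eq_Icc M ▸ isCompact_Icc

theorem convex_domain (M : Fin 3 → ℕ) : Convex ℝ (domain M) :=
  domain_eq_Icc M ▸ convex_Icc _ _

theorem mem_latticePeriod {N : ℕ} (hN : 0 < N) {M : Fin 3 → ℕ} {l : LPt}
    (h : latticePt N l ∈ domain M) : l ∈ latticePeriod N M := by
  have : (0 : ℝ) < N := Nat.cast_pos.2 hN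
  rw [latticePeriod, Fintype.mem_piFinset]
  intro i
  have hscale : (l i : ℝ) = N * latticePt N l i := by
    simp only [latticePt, spacing]
    field_simp
  have hlower : (N : ℝ) * (-(M i : ℝ) + 1) ≤ l i := hscale ▸ by gcongr; exact (h i).1
  have hupper : (l i : ℝ) ≤ N * M i := hscale ▸ by gcongr; exact (h i).2
  exact Finset.mem_Icc.2 ⟨by exact_mod_cast hlower, by exact_mod_cast hupper⟩

theorem latticePt_mem_closure_bondVolume {N : ℕ} (hN : 0 < N) {η : LPt} (hη : ∀ i, η i ≠ 0)
    (l : LPt) : latticePt N l ∈ closure (bondVolume N η l) := by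
  rw [closure_bondVolume hN hη]
  exact fun i _ => left_mem_uIcc

theorem exists_mem_closure_inter_of_locallyFinite {X ι : Type*} [TopologicalSpace X]
    {K : ι → Set X} (hK : LocallyFinite K) {A : Set X} (hA : A ⊆ ⋃ i, K i) {x : X}
    (hx : x ∈ closure A) : ∃ i, x ∈ closure (K i ∩ A) := by
  rwa [← mem_iUnion, ← (hK.subset fun i => inter_subset_left).closure_iUnion, ← iUnion_inter,
    inter_eq_right.2 hA]

theorem exists_mem_hull_and_inter_nonempty {N : ℕ} {𝒯 : Set (Finset LPt)} (h𝒯 : 𝒯.Finite)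
    {A : Set Pt} (hA : ∀ y ∈ A, ∃ T ∈ 𝒯, y ∈ hull N T) {x : Pt} (hx : x ∈ closure A) :
    ∃ T ∈ 𝒯, x ∈ hull N T ∧ (hull N T ∩ A).Nonempty := by
  have := h𝒯.to_subtype
  obtain ⟨⟨T, hT⟩, hxT⟩ := exists_mem_closure_inter_of_locallyFinite
    (locallyFinite_of_finite fun T : 𝒯 => hull N T)
    (fun y hy => let ⟨T, hT, hyT⟩ := hA y hy; mem_iUnion.2 ⟨⟨T, hT⟩, hyT⟩) hx
  exact ⟨T, hT, (isCompact_hull N T).isClosed.closure_subset_iff.2 inter_subset_left hxT,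
    closure_nonempty_iff.1 ⟨x, hxT⟩⟩

theorem IsDecomposition.exists_mem_hull {N : ℕ} {𝒯 : Finset (Finset LPt)} {U : Set Pt}
    (h : IsDecomposition N 𝒯 U) {x : Pt} (hx : x ∈ closure U) : ∃ T ∈ 𝒯, x ∈ hull N T := by
  rw [← h.cover] at hx
  simpa only [mem_iUnion, exists_prop] using hx

theorem IsDecomposition.hull_subset {N : ℕ} {𝒯 : Finset (Finset LPt)} {U : Set Pt}
    (h : IsDecomposition N 𝒯 U) {T : Finset LPt} (hT : T ∈ 𝒯) : hull N T ⊆ closure U :=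
  h.cover ▸ fun _ hx => mem_biUnion hT hx

theorem IsDecomposition.agree {N : ℕ} (hN : 0 < N) {𝒯 : Finset (Finset LPt)} {U : Set Pt}
    (h : IsDecomposition N 𝒯 U) : Agree N 𝒯 𝒯 :=
  h.conforming.agree hN h.tetrahedron h.tetrahedron

theorem IsTetrahedron.mem_closure_positive_weights {N : ℕ} {T : Finset LPt} (hN : 0 < N)
    (hT : IsTetrahedron N T) {x : Pt} (hx : x ∈ hull N T) :
    x ∈ closure {y | ∃ w, IsBarycentric N T w y ∧ ∀ p ∈ T, 0 < w p} := by
  have hrange : latticePt N '' T = range hT.affineBasis := by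
    rw [image_eq_range]
    rfl
  have hint : interior (hull N T) = {y | ∀ p, 0 < hT.affineBasis.coord p y} := by
    rw [hull, hrange, hT.affineBasis.interior_convexHull]
  have hne : (interior (hull N T)).Nonempty := by
    rw [hull, hrange]
    exact ⟨_, hT.affineBasis.centroid_mem_interior_convexHull⟩
  have hdense : closure (interior (hull N T)) = closure (hull N T) :=
    (convex_convexHull ℝ _).closure_interior_eq_closure_of_nonempty_interior hne
  refine closure_mono (fun y hy => ?_) (hdense.symm ▸ subset_closure hx)
  obtain ⟨w, hw⟩ := (mem_hull_iff hN).1 (interior_subset hy)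
  rw [hint] at hy
  exact ⟨w, hw, fun p hp => hT.coord_eq hw ⟨p, hp⟩ ▸ hy ⟨p, hp⟩⟩

theorem IsContinuumMesh.mem_of_mem_interface {N : ℕ} (hN : 0 < N) {Ωa Ωs : Set Pt}
    {𝒯c : Finset (Finset LPt)} (h : IsContinuumMesh N Ωa Ωs 𝒯c) {T : Finset LPt}
    (hT : T ∈ latticeTets N Ωs) {x : Pt} (hxT : x ∈ hull N T) (hx : x ∈ interface Ωa Ωs) :
    T ∈ 𝒯c := by
  obtain ⟨l, hTl⟩ := hT.1
  have htet := isTetrahedron_of_mem_typeA hN (fun _ => one_ne_zero) hTl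
  obtain ⟨T', hT', hxT', y, hyT', w, hw, hpos⟩ := exists_mem_hull_and_inter_nonempty
    𝒯c.finite_toSet (A := {y | ∃ w, IsBarycentric N T w y ∧ ∀ p ∈ T, 0 < w p})
    (fun y ⟨w, hw, _⟩ => h.decomposition.exists_mem_hull (hT.2 ((mem_hull_iff hN).2 ⟨w, hw⟩)))
    (htet.mem_closure_positive_weights hN hxT)
  have hlattice := h.lattice_at_interface T' hT' ⟨x, hxT', hx⟩
  rwa [eq_of_positive_weights_of_mem_hull hN hT hlattice hw hpos hyT']

namespace IsSplitting

variable {N : ℕ} {M : Fin 3 → ℕ} {R : Finset LPt} {Ωa Ωs : Set Pt}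

theorem notMem_closure_s (h : IsSplitting N M R Ωa Ωs) {x : Pt} (hx : x ∈ Ωa) :
    x ∉ closure Ωs :=
  Set.disjoint_left.1 (h.disjoint.closure_right h.region_a.isOpen) hx

theorem notMem_closure_a (h : IsSplitting N M R Ωa Ωs) {x : Pt} (hx : x ∈ Ωs) :
    x ∉ closure Ωa :=
  Set.disjoint_left.1 (h.disjoint.symm.closure_right h.region_s.isOpen) hx

theorem a_subset_domain (h : IsSplitting N M R Ωa Ωs) : Ωa ⊆ domain M :=
  h.cover ▸ subset_closure.trans subset_union_left

theorem s_subset_domain (h : IsSplitting N M R Ωa Ωs) : Ωs ⊆ domain M :=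
  h.cover ▸ subset_closure.trans subset_union_right

theorem bondVolume_subset_of_inContinuum (h : IsSplitting N M R Ωa Ωs) {η : LPt} (hη : η ∈ R)
    {l : LPt} {x : Pt} (hx : x ∈ closure (bondVolume N η l)) (hxa : x ∈ closure Ωa)
    (hl : InContinuum N M Ωs η l) : bondVolume N η l ⊆ Ωs :=
  hl.resolve_right fun hn =>
    hn ((subset_closure.trans (h.distance η hη l ⟨x, hx, hxa⟩)).trans interior_subset)

theorem notMem_of_inAtomistic_of_inContinuum (h : IsSplitting N M R Ωa Ωs) {η : LPt}
    (hη : η ∈ R) {l l' : LPt} (hl : InAtomistic N Ωa η l) (hl' : InContinuum N M Ωs η l') {x : Pt}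
    (hx : x ∈ closure (bondVolume N η l)) (hxa : x ∈ closure Ωa) :
    x ∉ closure (bondVolume N η l') := fun hx' =>
  h.notMem_closure_s (hl hx) (closure_mono (h.bondVolume_subset_of_inContinuum hη hx' hxa hl') hx')

end IsSplitting

namespace IsInterfaceDecomposition

variable {N : ℕ} {M : Fin 3 → ℕ} {R : Finset LPt} {Ωa Ωs : Set Pt}
  {dec : LPt → LPt → Finset (Finset LPt)} {η l : LPt}

theorem isTetrahedron (hN : 0 < N) (h : IsInterfaceDecomposition N M R Ωa Ωs dec) (hηR : η ∈ R)
    (hη : ∀ i, η i ≠ 0) {T : Finset LPt} (hT : T ∈ bondMesh N M Ωa Ωs dec η l) :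
    IsTetrahedron N T := by
  unfold bondMesh at hT
  split_ifs at hT with ha hb
  · exact isTetrahedron_of_mem_typeA hN hη hT
  · exact isTetrahedron_of_mem_typeA hN (fun _ => one_ne_zero) hT.1.choose_spec
  · exact (h.decomposition η hηR l ⟨ha, hb⟩).tetrahedron T hT

theorem hull_subset (hN : 0 < N) (h : IsInterfaceDecomposition N M R Ωa Ωs dec) (hηR : η ∈ R)
    (hη : ∀ i, η i ≠ 0) {T : Finset LPt} (hT : T ∈ bondMesh N M Ωa Ωs dec η l) :
    hull N T ⊆ closure (bondVolume N η l) := by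
  unfold bondMesh at hT
  split_ifs at hT with ha hb
  · exact hull_subset_closure_bondVolume hN hη hT
  · exact hT.2
  · exact (h.decomposition η hηR l ⟨ha, hb⟩).hull_subset hT

theorem exists_mem_hull (hN : 0 < N) (h : IsInterfaceDecomposition N M R Ωa Ωs dec) (hηR : η ∈ R)
    (hη : ∀ i, η i ≠ 0) {x : Pt} (hx : x ∈ closure (bondVolume N η l)) :
    ∃ T ∈ bondMesh N M Ωa Ωs dec η l, x ∈ hull N T := by
  unfold bondMesh
  split_ifs with ha hb
  · exact exists_typeA_mem_hull hN hη hx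
  · exact exists_latticeTet_mem_hull hN hη hx
  · exact (h.decomposition η hηR l ⟨ha, hb⟩).exists_mem_hull hx

end IsInterfaceDecomposition

theorem finite_bondMesh {N : ℕ} {M : Fin 3 → ℕ} {Ωa Ωs : Set Pt}
    {dec : LPt → LPt → Finset (Finset LPt)} {η l : LPt} (hl : ¬ InContinuum N M Ωs η l) :
    (bondMesh N M Ωa Ωs dec η l).Finite := by
  unfold bondMesh
  split_ifs
  exacts [Finset.finite_toSet _, Finset.finite_toSet _]

theorem IsLatticeRegion.interior_closure {N : ℕ} {M : Fin 3 → ℕ} {U : Set Pt}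
    (h : IsLatticeRegion N M U) : interior (closure U) = U := by
  obtain ⟨⟨𝒮, -, rfl⟩, -⟩ := h
  exact interior_closure_idem

theorem IsDecomposition.ae_mem_interior_closure {N : ℕ} {𝒯 : Finset (Finset LPt)} {U : Set Pt}
    (h : IsDecomposition N 𝒯 U) : ∀ᵐ x : Pt, x ∈ closure U → x ∈ interior (closure U) := by
  have hfrontier : ∀ᵐ x : Pt, ∀ T ∈ 𝒯, x ∉ frontier (hull N T) :=
    (Finset.eventually_all 𝒯).2 fun T _ =>
      measure_eq_zero_iff_ae_notMem.1 ((convex_convexHull ℝ _).addHaar_frontier volume)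
  filter_upwards [hfrontier] with x hx hxU
  obtain ⟨T, hT, hxT⟩ := h.exists_mem_hull hxU
  by_contra hint
  exact hx T hT ⟨subset_closure hxT, fun hxint => hint (interior_mono (h.hull_subset hT) hxint)⟩

theorem IsSplitting.union_ae_eq_domain {N : ℕ} {M : Fin 3 → ℕ} {R : Finset LPt} {Ωa Ωs : Set Pt}
    (h : IsSplitting N M R Ωa Ωs) {𝒯c : Finset (Finset LPt)} (h𝒯c : IsDecomposition N 𝒯c Ωs) :
    (Ωa ∪ Ωs : Set Pt) =ᵐ[volume] domain M := by
  filter_upwards [h𝒯c.ae_mem_interior_closure] with x hx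
  refine propext ⟨fun hu => union_subset h.a_subset_domain h.s_subset_domain hu, fun hxM => ?_⟩
  by_cases hxs : x ∈ closure Ωs
  · exact Or.inr (h.region_s.interior_closure ▸ hx hxs)
  have hclosure : domain M ∩ (closure Ωs)ᶜ ⊆ closure Ωa := fun y ⟨hyM, hys⟩ =>
    (h.cover ▸ hyM : y ∈ closure Ωa ∪ closure Ωs).resolve_right hys
  have hxint := h.interior_domain (hclosure ⟨hxM, hxs⟩)
  left
  rw [← h.region_a.interior_closure]
  exact interior_maximal ((inter_subset_inter_left _ interior_subset).trans hclosure)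
    (isOpen_interior.inter isClosed_closure.isOpen_compl) ⟨hxint, hxs⟩

/-! ### Gluing the local interpolants -/

open Classical in
/-- The field whose strain the energy samples on a bond volume that meets the closed atomistic
region: the interpolant `v^{ℓ,η}` in the classes (a) and (c), and `v` itself in class (b). -/
def localField (N : ℕ) (M : Fin 3 → ℕ) (Ωa Ωs : Set Pt) (dec : LPt → LPt → Finset (Finset LPt))
    (v : Pt → Pt) (η l : LPt) : Pt → Pt :=
  if InAtomistic N Ωa η l then interpolant N (typeA l η) v
  else if InContinuum N M Ωs η l then v
  else interpolant N (dec η l) v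

/-- The index, congruent to `r` modulo `η`, of a bond volume whose closure contains `x`. -/
def cellIndex (N : ℕ) (η r : LPt) (x : Pt) : LPt := r + η * fun i => ⌊relCoord N η r x i⌋

open Classical in
/-- The global field of the residue class of `r` modulo `η`: the bond volumes `B_{r+ηm,η}` tile
space, and their local fields on the closed atomistic region are continued by `v`. -/
def gluedField (N : ℕ) (M : Fin 3 → ℕ) (Ωa Ωs : Set Pt) (dec : LPt → LPt → Finset (Finset LPt))
    (v : Pt → Pt) (η r : LPt) (x : Pt) : Pt :=
  if x ∈ closure Ωa then localField N M Ωa Ωs dec v η (cellIndex N η r x) x else v x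

theorem mem_closure_cellIndex {N : ℕ} (hN : 0 < N) {η : LPt} (hη : ∀ i, η i ≠ 0) (r : LPt)
    (x : Pt) : x ∈ closure (bondVolume N η (cellIndex N η r x)) := by
  rw [mem_closure_bondVolume_iff hN hη]
  intro i
  rw [cellIndex, relCoord_add_mul hη]
  exact ⟨Int.fract_nonneg _, (Int.fract_lt_one _).le⟩

theorem locallyFinite_closure_bondVolume {N : ℕ} (hN : 0 < N) {η : LPt} (hη : ∀ i, η i ≠ 0)
    (r : LPt) : LocallyFinite fun m => closure (bondVolume N η (r + η * m)) := by
  intro x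
  refine ⟨relCoord N η r ⁻¹' Metric.ball (relCoord N η r x) 1,
    (continuous_relCoord N η r).continuousAt.preimage_mem_nhds (Metric.ball_mem_nhds _ one_pos), ?_⟩
  refine (Set.finite_Icc (fun i => ⌊relCoord N η r x i⌋ - 2)
    (fun i => ⌊relCoord N η r x i⌋ + 1)).subset ?_
  rintro m ⟨y, hy, hball⟩
  rw [mem_closure_bondVolume_iff hN hη] at hy
  have hbound : ∀ i, ⌊relCoord N η r x i⌋ - 2 ≤ m i ∧ m i ≤ ⌊relCoord N η r x i⌋ + 1 := fun i => by
    have hdist := (dist_le_pi_dist _ _ i).trans_lt (Metric.mem_ball.1 hball)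
    rw [Real.dist_eq, abs_lt] at hdist
    have hyi := hy i
    rw [relCoord_add_mul hη] at hyi
    have hfloor := Int.floor_le (relCoord N η r x i)
    have hfloor' := Int.lt_floor_add_one (relCoord N η r x i)
    have hlower : (⌊relCoord N η r x i⌋ : ℝ) - 2 ≤ m i := by linarith [hyi.2]
    have hupper : (m i : ℝ) < ⌊relCoord N η r x i⌋ + 1 + 1 := by linarith [hyi.1]
    exact ⟨by exact_mod_cast hlower, Int.le_of_lt_add_one (by exact_mod_cast hupper)⟩
  exact ⟨fun i => (hbound i).1, fun i => (hbound i).2⟩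

/-- The data of the proposition: a splitting of `Ω`, decompositions of the bond volumes at the
interface, a mesh of the continuum region, and a test function `v`. -/
structure IsCoupledProblem (N k : ℕ) (M : Fin 3 → ℕ) (R : Finset LPt) (Ωa Ωs : Set Pt)
    (dec : LPt → LPt → Finset (Finset LPt)) (𝒯c : Finset (Finset LPt)) (v : Pt → Pt) : Prop where
  pos : 0 < N
  bond : ∀ η ∈ R, ∀ i, η i ≠ 0
  splitting : IsSplitting N M R Ωa Ωs
  interfaceDec : IsInterfaceDecomposition N M R Ωa Ωs dec
  mesh : IsContinuumMesh N Ωa Ωs 𝒯c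
  mem : MemCoupledSpace N k M Ωa Ωs 𝒯c v

namespace IsCoupledProblem

variable {N k : ℕ} {M : Fin 3 → ℕ} {R : Finset LPt} {Ωa Ωs : Set Pt}
  {dec : LPt → LPt → Finset (Finset LPt)} {𝒯c : Finset (Finset LPt)} {v : Pt → Pt} {η l : LPt}
  {x : Pt}

theorem eq_sum_of_mem_interface (h : IsCoupledProblem N k M R Ωa Ωs dec 𝒯c v) {T : Finset LPt}
    (hT : T ∈ latticeTets N Ωs) {w : LPt → ℝ} (hw : IsBarycentric N T w x)
    (hx : x ∈ interface Ωa Ωs) : v x = ∑ p ∈ T, w p • v (latticePt N p) := by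
  have hxT : x ∈ hull N T := (mem_hull_iff h.pos).2 ⟨w, hw⟩
  have hlinear : IsPolyOn 1 v (hull N T) :=
    h.mem.continuum.linear T (h.mesh.mem_of_mem_interface h.pos hT hxT hx) ⟨x, hxT, hx⟩
  rw [← hw.2.2]
  exact hlinear.sum_smul (convex_convexHull ℝ _) hw.1 hw.2.1 fun p => latticePt_mem_hull

theorem localField_eq_sum (h : IsCoupledProblem N k M R Ωa Ωs dec 𝒯c v) (hη : η ∈ R)
    {T : Finset LPt} (hT : T ∈ bondMesh N M Ωa Ωs dec η l) {w : LPt → ℝ}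
    (hw : IsBarycentric N T w x) (hxa : x ∈ closure Ωa) :
    localField N M Ωa Ωs dec v η l x = ∑ p ∈ T, w p • v (latticePt N p) := by
  have hxB : x ∈ closure (bondVolume N η l) := h.interfaceDec.hull_subset h.pos hη (h.bond η hη) hT
    ((mem_hull_iff h.pos).2 ⟨w, hw⟩)
  unfold bondMesh at hT
  unfold localField
  split_ifs at hT ⊢ with ha hb
  · exact interpolant_eq h.pos (agree_typeA_self h.pos (h.bond η hη) l) hT hw v
  · have hsub := closure_mono (h.splitting.bondVolume_subset_of_inContinuum hη hxB hxa hb)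
    exact h.eq_sum_of_mem_interface ⟨hT.1, hT.2.trans hsub⟩ hw ⟨hxa, hsub hxB⟩
  · exact interpolant_eq h.pos ((h.interfaceDec.decomposition η hη l ⟨ha, hb⟩).agree h.pos) hT hw v

theorem agree_bondMesh_of_face (h : IsCoupledProblem N k M R Ωa Ωs dec 𝒯c v) (hη : η ∈ R)
    {i : Fin 3} (hx : x ∈ closure (bondVolume N η l))
    (hx' : x ∈ closure (bondVolume N η (l + Pi.single i (η i)))) (hxa : x ∈ closure Ωa) :
    Agree N (bondMesh N M Ωa Ωs dec η l)
      (bondMesh N M Ωa Ωs dec η (l + Pi.single i (η i))) := by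
  have hb := h.bond η hη
  have htet : ∀ l, ∀ T ∈ bondMesh N M Ωa Ωs dec η l, IsTetrahedron N T :=
    fun l T => h.interfaceDec.isTetrahedron h.pos hη hb
  set l' := l + Pi.single i (η i) with hl'
  have hmesh : ∀ m, AtInterface N M Ωa Ωs η m → bondMesh N M Ωa Ωs dec η m = dec η m :=
    fun m hm => by rw [bondMesh, if_neg hm.1, if_neg hm.2]
  by_cases hc : AtInterface N M Ωa Ωs η l
  · refine Conforming.agree h.pos ?_ (htet l) (htet l')
    rw [hmesh l hc]
    exact (h.interfaceDec.compatible η hη l hc i).1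
  by_cases hc' : AtInterface N M Ωa Ωs η l'
  · refine (Conforming.agree h.pos ?_ (htet l') (htet l)).symm
    rw [hmesh l' hc', ← add_sub_cancel_right l (Pi.single i (η i)), ← hl']
    exact (h.interfaceDec.compatible η hη l' hc' i).2
  by_cases ha : InAtomistic N Ωa η l <;> by_cases ha' : InAtomistic N Ωa η l'
  · rw [bondMesh, bondMesh, if_pos ha, if_pos ha', hl', ← mul_one (η i), Pi.single_mul_right]
    exact agree_typeA h.pos hb l _
  · exact absurd hx' (h.splitting.notMem_of_inAtomistic_of_inContinuum hη ha
      (not_not.1 fun hn => hc' ⟨ha', hn⟩) hx hxa)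
  · exact absurd hx (h.splitting.notMem_of_inAtomistic_of_inContinuum hη ha'
      (not_not.1 fun hn => hc ⟨ha, hn⟩) hx' hxa)
  · rw [bondMesh, bondMesh, if_neg ha, if_neg ha', if_pos (not_not.1 fun hn => hc ⟨ha, hn⟩),
      if_pos (not_not.1 fun hn => hc' ⟨ha', hn⟩)]
    exact agree_latticeTets h.pos _ _

theorem localField_eq_of_face (h : IsCoupledProblem N k M R Ωa Ωs dec 𝒯c v) (hη : η ∈ R)
    {i : Fin 3} (hx : x ∈ closure (bondVolume N η l))
    (hx' : x ∈ closure (bondVolume N η (l + Pi.single i (η i)))) (hxa : x ∈ closure Ωa) :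
    localField N M Ωa Ωs dec v η (l + Pi.single i (η i)) x = localField N M Ωa Ωs dec v η l x := by
  obtain ⟨S, hS, hxS⟩ := h.interfaceDec.exists_mem_hull h.pos hη (h.bond η hη) hx
  obtain ⟨T, hT, hxT⟩ := h.interfaceDec.exists_mem_hull h.pos hη (h.bond η hη) hx'
  obtain ⟨w, hw⟩ := (mem_hull_iff h.pos).1 hxS
  obtain ⟨w', hw'⟩ := (mem_hull_iff h.pos).1 hxT
  rw [h.localField_eq_sum hη hS hw hxa, h.localField_eq_sum hη hT hw' hxa]
  exact (h.agree_bondMesh_of_face hη hx hx' hxa S hS T hT w w' x hw hw' _).symm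

theorem localField_add_single (h : IsCoupledProblem N k M R Ωa Ωs dec 𝒯c v) (hη : η ∈ R)
    {i : Fin 3} {δ : ℤ} (hx : x ∈ closure (bondVolume N η l))
    (hx' : x ∈ closure (bondVolume N η (l + η * Pi.single i δ))) (hxa : x ∈ closure Ωa) :
    localField N M Ωa Ωs dec v η (l + η * Pi.single i δ) x =
      localField N M Ωa Ωs dec v η l x := by
  have hi := (mem_closure_bondVolume_iff h.pos (h.bond η hη)).1 hx i
  have hi' := (mem_closure_bondVolume_iff h.pos (h.bond η hη)).1 hx' i
  rw [relCoord_add_mul (h.bond η hη), Pi.single_eq_same] at hi'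
  have hδ_le : (δ : ℝ) ≤ 1 := by linarith [hi.2, hi'.1]
  have hδ_ge : (-1 : ℝ) ≤ δ := by linarith [hi.1, hi'.2]
  have hδ : δ = -1 ∨ δ = 0 ∨ δ = 1 := by
    have : δ ≤ 1 := by exact_mod_cast hδ_le
    have : -1 ≤ δ := by exact_mod_cast hδ_ge
    omega
  rw [← Pi.single_mul_right] at hx' ⊢
  rcases hδ with rfl | rfl | rfl
  · have hback : l + Pi.single i (η i * -1) + Pi.single i (η i) = l := by
      rw [add_assoc, ← Pi.single_add, mul_neg_one, neg_add_cancel, Pi.single_zero, add_zero]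
    rw [← h.localField_eq_of_face hη hx' (hback.symm ▸ hx) hxa, hback]
  · rw [mul_zero, Pi.single_zero, add_zero]
  · rw [mul_one] at hx' ⊢
    exact h.localField_eq_of_face hη hx hx' hxa

theorem localField_add_mul (h : IsCoupledProblem N k M R Ωa Ωs dec 𝒯c v) (hη : η ∈ R)
    {m : LPt} (hx : x ∈ closure (bondVolume N η l))
    (hx' : x ∈ closure (bondVolume N η (l + η * m))) (hxa : x ∈ closure Ωa) :
    localField N M Ωa Ωs dec v η (l + η * m) x = localField N M Ωa Ωs dec v η l x := by
  classical
  have hb := h.bond η hη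
  have hmem : ∀ s : Finset (Fin 3),
      x ∈ closure (bondVolume N η (l + η * s.piecewise m 0)) := fun s => by
    rw [mem_closure_bondVolume_iff h.pos hb] at hx hx' ⊢
    intro i
    by_cases hi : i ∈ s
    · simpa only [relCoord_add_mul hb, s.piecewise_eq_of_mem m 0 hi] using hx' i
    · simpa [relCoord_add_mul hb, s.piecewise_eq_of_notMem m 0 hi] using hx i
  have hpartial : ∀ s : Finset (Fin 3),
      localField N M Ωa Ωs dec v η (l + η * s.piecewise m 0) x =
        localField N M Ωa Ωs dec v η l x := fun s => by
    induction s using Finset.induction_on with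
    | empty => simp
    | insert i s hi ih =>
      have hstep : l + η * (insert i s).piecewise m 0 =
          l + η * s.piecewise m 0 + η * Pi.single i (m i) := by
        rw [add_assoc, ← mul_add]
        congr 2
        ext j
        rcases eq_or_ne j i with rfl | hj
        · simp [hi]
        · simp [hj, Finset.piecewise]
      rw [hstep, h.localField_add_single hη (hmem s) (hstep ▸ hmem (insert i s)) hxa, ih]
  simpa using hpartial Finset.univ

theorem localField_eq_of_mem_closure_inter (h : IsCoupledProblem N k M R Ωa Ωs dec 𝒯c v)
    (hη : η ∈ R) (hx : x ∈ closure (closure (bondVolume N η l) ∩ Ωs)) (hxa : x ∈ closure Ωa) :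
    localField N M Ωa Ωs dec v η l x = v x := by
  have hxB : x ∈ closure (bondVolume N η l) :=
    isClosed_closure.closure_subset_iff.2 inter_subset_left hx
  have hxs : x ∈ closure Ωs := closure_mono inter_subset_right hx
  have ha : ¬ InAtomistic N Ωa η l := fun ha => h.splitting.notMem_closure_s (ha hxB) hxs
  by_cases hb : InContinuum N M Ωs η l
  · rw [localField, if_neg ha, if_pos hb]
  have hc : AtInterface N M Ωa Ωs η l := ⟨ha, hb⟩
  obtain ⟨T, hT, hxT, y, hyT, -, hys⟩ := exists_mem_hull_and_inter_nonempty
    (finite_bondMesh (Ωa := Ωa) (dec := dec) hb) (fun y hy => h.interfaceDec.exists_mem_hull h.pos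
      hη (h.bond η hη) hy.1) hx
  have hTdec : T ∈ dec η l := by rwa [bondMesh, if_neg ha, if_neg hb] at hT
  have hsub : hull N T ⊆ closure Ωs := (h.interfaceDec.resolves η hη l hc T hTdec).resolve_left
    fun hn => h.splitting.notMem_closure_a hys (hn hyT)
  obtain ⟨w, hw⟩ := (mem_hull_iff h.pos).1 hxT
  rw [h.localField_eq_sum hη hT hw hxa, h.eq_sum_of_mem_interface
    (h.interfaceDec.continuum η hη l hc T hTdec hsub) hw ⟨hxa, hxs⟩]

theorem localField_eq_of_mem_interface (h : IsCoupledProblem N k M R Ωa Ωs dec 𝒯c v)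
    (hη : η ∈ R) (hx : x ∈ closure (bondVolume N η l)) (hΓ : x ∈ interface Ωa Ωs) :
    localField N M Ωa Ωs dec v η l x = v x := by
  have hcover : Ωs ⊆ ⋃ m, closure (bondVolume N η (l + η * m)) := fun y _ =>
    mem_iUnion.2 ⟨_, mem_closure_cellIndex h.pos (h.bond η hη) l y⟩
  obtain ⟨m, hm⟩ := exists_mem_closure_inter_of_locallyFinite
    (locallyFinite_closure_bondVolume h.pos (h.bond η hη) l) hcover hΓ.2
  have hxm := isClosed_closure.closure_subset_iff.2 inter_subset_left hm
  rw [← h.localField_add_mul hη hx hxm hΓ.1, h.localField_eq_of_mem_closure_inter hη hm hΓ.1]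

theorem gluedField_eq_of_mem_closure_s (h : IsCoupledProblem N k M R Ωa Ωs dec 𝒯c v)
    (hη : η ∈ R) (r : LPt) (hx : x ∈ closure Ωs) : gluedField N M Ωa Ωs dec v η r x = v x := by
  unfold gluedField
  split_ifs with hxa
  · exact h.localField_eq_of_mem_interface hη
      (mem_closure_cellIndex h.pos (h.bond η hη) r x) ⟨hxa, hx⟩
  · rfl

theorem gluedField_eq_localField (h : IsCoupledProblem N k M R Ωa Ωs dec 𝒯c v) (hη : η ∈ R)
    {r m : LPt} (hx : x ∈ closure Ωa) (hxm : x ∈ closure (bondVolume N η (r + η * m))) :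
    gluedField N M Ωa Ωs dec v η r x = localField N M Ωa Ωs dec v η (r + η * m) x := by
  have hcell := mem_closure_cellIndex h.pos (h.bond η hη) r x
  have hshift : cellIndex N η r x = r + η * m + η * ((fun i => ⌊relCoord N η r x i⌋) - m) := by
    rw [add_assoc, ← mul_add, add_sub_cancel]
    rfl
  rw [gluedField, if_pos hx]
  rw [hshift] at hcell ⊢
  exact h.localField_add_mul hη hxm hcell hx

theorem exists_lipschitzOnWith_gluedField_hull_mesh (h : IsCoupledProblem N k M R Ωa Ωs dec 𝒯c v)
    (hη : η ∈ R) (r : LPt) {T : Finset LPt} (hT : T ∈ 𝒯c) :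
    ∃ C, LipschitzOnWith C (gluedField N M Ωa Ωs dec v η r) (hull N T) := by
  have hv : ∃ C, LipschitzOnWith C v (hull N T) := by
    by_cases hΓ : (hull N T ∩ interface Ωa Ωs).Nonempty
    · exact (h.mem.continuum.linear T hT hΓ).exists_lipschitzOnWith (isCompact_hull N T)
    · exact (h.mem.continuum.poly T hT hΓ).exists_lipschitzOnWith (isCompact_hull N T)
  obtain ⟨C, hC⟩ := hv
  have heq : ∀ x ∈ hull N T, gluedField N M Ωa Ωs dec v η r x = v x := fun x hx =>
    h.gluedField_eq_of_mem_closure_s hη r (h.mesh.decomposition.hull_subset hT hx)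
  exact ⟨C, fun x hx y hy => by rw [heq x hx, heq y hy]; exact hC hx hy⟩

theorem exists_lipschitzOnWith_gluedField_hull_bondMesh
    (h : IsCoupledProblem N k M R Ωa Ωs dec 𝒯c v) (hη : η ∈ R) {r m : LPt} {T : Finset LPt}
    (hT : T ∈ bondMesh N M Ωa Ωs dec η (r + η * m)) :
    ∃ C, LipschitzOnWith C (gluedField N M Ωa Ωs dec v η r) (hull N T ∩ closure Ωa) := by
  have hsub := h.interfaceDec.hull_subset h.pos hη (h.bond η hη) hT
  refine (h.interfaceDec.isTetrahedron h.pos hη (h.bond η hη) hT).exists_lipschitzOnWith h.pos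
    (g := fun p => v (latticePt N p)) fun w x hxa hw => ?_
  rw [h.gluedField_eq_localField hη hxa (hsub ((mem_hull_iff h.pos).2 ⟨w, hw⟩)),
    h.localField_eq_sum hη hT hw hxa]

theorem finite_cellIndex_image (h : IsCoupledProblem N k M R Ωa Ωs dec 𝒯c v) (hη : η ∈ R)
    (r : LPt) : (cellIndex N η r '' (closure Ωa \ closure Ωs)).Finite := by
  refine (latticePeriod N M).finite_toSet.subset ?_
  rintro _ ⟨x, ⟨hxa, -⟩, rfl⟩
  have hx := mem_closure_cellIndex h.pos (h.bond η hη) r x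
  exact mem_latticePeriod h.pos (interior_subset (h.splitting.distance η hη _ ⟨x, hx, hxa⟩
    (latticePt_mem_closure_bondVolume h.pos (h.bond η hη) _)))

theorem exists_lipschitzOnWith_gluedField (h : IsCoupledProblem N k M R Ωa Ωs dec 𝒯c v)
    (hη : η ∈ R) (r : LPt) :
    ∃ C, LipschitzOnWith C (gluedField N M Ωa Ωs dec v η r) (domain M) := by
  refine exists_lipschitzOnWith_of_finite_closed_cover (convex_domain M)
    (𝒦 := hull N '' 𝒯c ∪ ⋃ l ∈ cellIndex N η r '' (closure Ωa \ closure Ωs),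
      (fun T => hull N T ∩ closure Ωa) '' bondMesh N M Ωa Ωs dec η l)
    ((𝒯c.finite_toSet.image _).union ((h.finite_cellIndex_image hη r).biUnion ?_)) ?_ ?_ ?_
  · rintro _ ⟨x, ⟨hxa, hxs⟩, rfl⟩
    have hx := mem_closure_cellIndex h.pos (h.bond η hη) r x
    exact (finite_bondMesh fun hb => hxs (closure_mono
      (h.splitting.bondVolume_subset_of_inContinuum hη hx hxa hb) hx)).image _
  · rintro K (⟨T, -, rfl⟩ | hK)
    · exact (isCompact_hull N T).isClosed
    · obtain ⟨l, -, T, -, rfl⟩ := mem_iUnion₂.1 hK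
      exact (isCompact_hull N T).isClosed.inter isClosed_closure
  · rintro K (⟨T, hT, rfl⟩ | hK)
    · exact h.exists_lipschitzOnWith_gluedField_hull_mesh hη r hT
    · obtain ⟨_, ⟨x, -, rfl⟩, T, hT, rfl⟩ := mem_iUnion₂.1 hK
      exact h.exists_lipschitzOnWith_gluedField_hull_bondMesh hη hT
  · intro x hx
    by_cases hxs : x ∈ closure Ωs
    · obtain ⟨T, hT, hxT⟩ := h.mesh.decomposition.exists_mem_hull hxs
      exact ⟨hull N T, Or.inl ⟨T, hT, rfl⟩, hxT⟩
    · rw [h.splitting.cover] at hx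
      have hxa := hx.resolve_right hxs
      obtain ⟨T, hT, hxT⟩ := h.interfaceDec.exists_mem_hull h.pos hη (h.bond η hη)
        (mem_closure_cellIndex h.pos (h.bond η hη) r x)
      exact ⟨hull N T ∩ closure Ωa, Or.inr (mem_biUnion ⟨x, ⟨hxa, hxs⟩, rfl⟩ ⟨T, hT, rfl⟩),
        hxT, hxa⟩

theorem gluedField_update (h : IsCoupledProblem N k M R Ωa Ωs dec 𝒯c v) (hη : η ∈ R) (r : LPt)
    (i : Fin 3) (hx : x ∈ domain M) (hxi : x i = -(M i : ℝ) + 1) :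
    gluedField N M Ωa Ωs dec v η r (Function.update x i (M i)) =
      gluedField N M Ωa Ωs dec v η r x := by
  have hupdate : Function.update x i (M i : ℝ) = x + Pi.single i (2 * (M i : ℝ) - 1) := by
    ext j
    rcases eq_or_ne j i with rfl | hj
    · rw [Function.update_self, Pi.add_apply, hxi, Pi.single_eq_same]
      ring
    · simp [hj]
  have hmem : Function.update x i (M i : ℝ) ∈ domain M := fun j => by
    rcases eq_or_ne j i with rfl | hj
    · simpa using (hx j).1.trans (hx j).2
    · simpa [hj] using hx j
  have hface : ∀ y ∈ domain M, y i = -(M i : ℝ) + 1 ∨ y i = M i → y ∈ closure Ωs := by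
    intro y hy hyi
    refine (h.splitting.cover ▸ hy : y ∈ closure Ωa ∪ closure Ωs).resolve_left fun hya => ?_
    have hint := h.splitting.interior_domain hya
    rw [domain_eq_Icc, ← pi_univ_Icc, interior_pi_set finite_univ] at hint
    simp only [interior_Icc] at hint
    have hyi' := hint i (mem_univ i)
    rcases hyi with hyi | hyi
    exacts [hyi'.1.ne' hyi, hyi'.2.ne hyi]
  rw [h.gluedField_eq_of_mem_closure_s hη r (hface x hx (Or.inl hxi)),
    h.gluedField_eq_of_mem_closure_s hη r (hface _ hmem (Or.inr (by simp))), hupdate]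
  exact h.mem.periodic i x hx (hupdate ▸ hmem)

theorem integral_fderiv_gluedField (h : IsCoupledProblem N k M R Ωa Ωs dec 𝒯c v) (hη : η ∈ R)
    (r : LPt) (d : Pt) :
    ∫ x in domain M, fderiv ℝ (gluedField N M Ωa Ωs dec v η r) x d = 0 := by
  obtain ⟨C, hC⟩ := h.exists_lipschitzOnWith_gluedField hη r
  rw [domain_eq_Icc] at hC ⊢
  exact integral_fderiv_eq_zero_of_periodic hC
    (fun i x hx hxi => h.gluedField_update hη r i (domain_eq_Icc M ▸ hx) hxi) d

end IsCoupledProblem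

theorem hasDerivAt_setIntegral_comp_fderiv {E F : Type*} [NormedAddCommGroup E] [NormedSpace ℝ E]
    [FiniteDimensional ℝ E] [MeasurableSpace E] [BorelSpace E] {μ : Measure E}
    [μ.IsAddHaarMeasure] [NormedAddCommGroup F] [NormedSpace ℝ F] [FiniteDimensional ℝ F]
    [MeasurableSpace F] [BorelSpace F] {S : Set E} (hS : IsOpen S) (hμS : μ S ≠ ⊤) {g : E → F}
    {C : ℝ≥0} (hg : LipschitzOnWith C g S) (A : E →L[ℝ] F) (d : E) {φ : F → ℝ}
    (hφm : Measurable φ) (hφ : DifferentiableAt ℝ φ (A d)) {y : ℝ → E → F}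
    (hy : ∀ t, EqOn (y t) (fun x => A x + t • g x) S) :
    HasDerivAt (fun t => ∫ x in S, φ (fderiv ℝ (y t) x d) ∂μ)
      (fderiv ℝ φ (A d) (∫ x in S, fderiv ℝ g x d ∂μ)) 0 := by
  have := FiniteDimensional.complete ℝ F
  have : IsFiniteMeasure (μ.restrict S) := isFiniteMeasure_restrict.2 hμS
  have hbound : ∀ᵐ x ∂μ.restrict S, ‖fderiv ℝ g x d‖ ≤ C * ‖d‖ := by
    filter_upwards [ae_restrict_mem hS.measurableSet] with x hx
    exact ContinuousLinearMap.le_of_opNorm_le _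
      (norm_fderiv_le_of_lipschitzOn ℝ (hS.mem_nhds hx) hg) d
  have hderiv := hasDerivAt_integral_comp_add_smul hφm hφ
    (measurable_fderiv_apply_const ℝ g d).aestronglyMeasurable hbound
  refine hderiv.congr_of_eventuallyEq (Eventually.of_forall fun t => ?_)
  refine setIntegral_congr_ae hS.measurableSet ?_
  filter_upwards [hg.ae_differentiableWithinAt_of_mem (μ := μ)] with x hdiff hx
  have hnhds := hS.mem_nhds hx
  have hsum : HasFDerivAt (fun x => A x + t • g x) (A + t • fderiv ℝ g x) x :=
    A.hasFDerivAt.add (((hdiff hx).differentiableAt hnhds).hasFDerivAt.const_smul t)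
  rw [((hy t).eventuallyEq_of_mem hnhds).fderiv_eq, hsum.fderiv]
  rfl

theorem setIntegral_fderiv_congr {E F : Type*} [NormedAddCommGroup E] [NormedSpace ℝ E]
    [MeasurableSpace E] [OpensMeasurableSpace E] [NormedAddCommGroup F] [NormedSpace ℝ F]
    {μ : Measure E} {S : Set E} (hS : IsOpen S) {f g : E → F} (h : EqOn f g S) (d : E) :
    ∫ x in S, fderiv ℝ f x d ∂μ = ∫ x in S, fderiv ℝ g x d ∂μ :=
  setIntegral_congr_fun hS.measurableSet fun x hx => by
    rw [(h.eventuallyEq_of_mem (hS.mem_nhds hx)).fderiv_eq]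

/-! ### Residue classes of bond volumes -/

theorem volume_bondVolume {N : ℕ} (hN : 0 < N) (η l : LPt) :
    volume.real (bondVolume N η l) = spacing N ^ 3 * |((η 0 * η 1 * η 2 : ℤ) : ℝ)| := by
  have hedge : ∀ i, max (latticePt N l i) (latticePt N (l + η) i) -
      min (latticePt N l i) (latticePt N (l + η) i) = spacing N * |(η i : ℝ)| := fun i => by
    rw [max_sub_min_eq_abs, latticePt_add, Pi.add_apply, add_sub_cancel_left, Pi.smul_apply,
      smul_eq_mul, abs_mul, abs_of_pos (spacing_pos hN), toVec]
  rw [bondVolume_eq_pi, measureReal_def]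
  refine (Real.volume_pi_Ioo_toReal fun i => min_le_max).trans ?_
  simp only [hedge, Fin.prod_univ_three, Int.cast_mul, abs_mul]
  ring

theorem ae_mem_bondVolume {N : ℕ} (hN : 0 < N) {η : LPt} (hη : ∀ i, η i ≠ 0) (r : LPt) :
    ∀ᵐ x : Pt, x ∈ bondVolume N η (cellIndex N η r x) := by
  have hgrid : ∀ᵐ x : Pt, ∀ (i : Fin 3) (z : ℤ),
      x i ≠ latticePt N r i + spacing N * η i * z :=
    ae_all_iff.2 fun i => ae_all_iff.2 fun z =>
      Measure.ae_eval_ne (fun _ : Fin 3 => (volume : Measure ℝ)) i _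
  filter_upwards [hgrid] with x hx
  rw [mem_bondVolume_iff hN hη]
  intro i
  rw [cellIndex, relCoord_add_mul hη]
  refine ⟨Int.fract_pos.2 fun hint => hx i ⌊relCoord N η r x i⌋ ?_, Int.fract_lt_one _⟩
  rw [← hint]
  exact apply_eq_add_mul_relCoord hN hη r x i

/-- The representative of `l` modulo `η`. -/
def residue (η l : LPt) : LPt := fun i => l i % η i

/-- The box of representatives of the lattice points modulo `η`. -/
def residues (η : LPt) : Finset LPt := Fintype.piFinset fun i => Finset.Ico 0 |η i|

theorem residue_add_mul_div (η l : LPt) : residue η l + η * (fun i => l i / η i) = l :=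
  funext fun i => Int.emod_add_mul_ediv (l i) (η i)

theorem residue_mem_residues {η : LPt} (hη : ∀ i, η i ≠ 0) (l : LPt) :
    residue η l ∈ residues η :=
  Fintype.mem_piFinset.2 fun i =>
    Finset.mem_Ico.2 ⟨Int.emod_nonneg _ (hη i), Int.emod_lt_abs _ (hη i)⟩

theorem residue_add_mul {η r : LPt} (hr : r ∈ residues η) (m : LPt) :
    residue η (r + η * m) = r := by
  ext i
  have hri := Finset.mem_Ico.1 (Fintype.mem_piFinset.1 hr i)
  rw [residue, Pi.add_apply, Pi.mul_apply, Int.add_mul_emod_self_left, ← Int.emod_abs]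
  exact Int.emod_eq_of_lt hri.1 hri.2

theorem card_residues (η : LPt) : ((residues η).card : ℝ) = |((η 0 * η 1 * η 2 : ℤ) : ℝ)| := by
  have hcard : ∀ i, ((Finset.Ico 0 |η i|).card : ℝ) = |(η i : ℝ)| := fun i => by
    rw [Int.card_Ico, sub_zero, ← Int.cast_natCast, Int.toNat_of_nonneg (abs_nonneg _),
      Int.cast_abs]
  rw [residues, Fintype.card_piFinset, Fin.prod_univ_three]
  push_cast
  rw [hcard, hcard, hcard, abs_mul, abs_mul]

theorem cellIndex_residue_of_mem {N : ℕ} (hN : 0 < N) {η : LPt} (hη : ∀ i, η i ≠ 0) {l : LPt}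
    {x : Pt} (hx : x ∈ bondVolume N η l) : cellIndex N η (residue η l) x = l := by
  conv_rhs => rw [← residue_add_mul_div η l]
  rw [cellIndex]
  congr 2
  ext i
  rw [← residue_add_mul_div η l, mem_bondVolume_iff hN hη] at hx
  obtain ⟨hlower, hupper⟩ := hx i
  rw [relCoord_add_mul hη] at hlower hupper
  exact Int.floor_eq_iff.2 ⟨by linarith, by linarith⟩

/-! ### Balance of the strains -/

/-- The strain in the direction of the bond, integrated over the atomistic part of the bond
volume. -/
def boxStrain (N : ℕ) (M : Fin 3 → ℕ) (Ωa Ωs : Set Pt) (dec : LPt → LPt → Finset (Finset LPt))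
    (v : Pt → Pt) (η l : LPt) : Pt :=
  ∫ x in bondVolume N η l ∩ Ωa, fderiv ℝ (localField N M Ωa Ωs dec v η l) x (toVec η)

theorem diffQuot_mulVec_add {N : ℕ} (hN : 0 < N) (F : Matrix (Fin 3) (Fin 3) ℝ) (t : ℝ)
    (v : Pt → Pt) (η l : LPt) : diffQuot N η (fun x => F.mulVec x + t • v x) l =
      F.mulVec (toVec η) + t • diffQuot N η v l := by
  have hη : F.mulVec (toVec η) =
      (spacing N)⁻¹ • (F.mulVec (latticePt N (l + η)) - F.mulVec (latticePt N l)) := by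
    rw [← Matrix.mulVec_sub, latticePt_add, add_sub_cancel_left, Matrix.mulVec_smul,
      inv_smul_smul₀ (spacing_pos hN).ne']
  rw [hη, diffQuot, diffQuot]
  module

open Classical in
theorem hasDerivAt_energyAtomistic {N : ℕ} (hN : 0 < N) (M : Fin 3 → ℕ) (Ωa : Set Pt) (η : LPt)
    (F : Matrix (Fin 3) (Fin 3) ℝ) {φ : Pt → ℝ} (hφ : DifferentiableAt ℝ φ (F.mulVec (toVec η)))
    (v : Pt → Pt) :
    HasDerivAt (fun t : ℝ => energyAtomistic N M Ωa φ η fun x => F.mulVec x + t • v x)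
      (fderiv ℝ φ (F.mulVec (toVec η)) (spacing N ^ 3 •
        ∑ l ∈ latticePeriod N M with InAtomistic N Ωa η l, diffQuot N η v l)) 0 := by
  simp only [energyAtomistic, diffQuot_mulVec_add hN, map_smul, map_sum, smul_eq_mul]
  refine (HasDerivAt.fun_sum fun l _ => ?_).const_mul _
  exact HasFDerivAt.comp_hasDerivAt 0 (by simpa using hφ.hasFDerivAt)
    (hasDerivAt_add_smul_const _ _ 0)

namespace IsCoupledProblem

variable {N k : ℕ} {M : Fin 3 → ℕ} {R : Finset LPt} {Ωa Ωs : Set Pt}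
  {dec : LPt → LPt → Finset (Finset LPt)} {𝒯c : Finset (Finset LPt)} {v : Pt → Pt} {η : LPt}

theorem gluedField_eqOn_s (h : IsCoupledProblem N k M R Ωa Ωs dec 𝒯c v) (hη : η ∈ R) (r : LPt) :
    EqOn v (gluedField N M Ωa Ωs dec v η r) Ωs :=
  fun _ hx => (h.gluedField_eq_of_mem_closure_s hη r (subset_closure hx)).symm

theorem gluedField_eqOn_bondVolume (h : IsCoupledProblem N k M R Ωa Ωs dec 𝒯c v) (hη : η ∈ R)
    (l : LPt) : EqOn (localField N M Ωa Ωs dec v η l)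
      (gluedField N M Ωa Ωs dec v η (residue η l)) (bondVolume N η l ∩ Ωa) := fun x hx => by
  rw [h.gluedField_eq_localField hη (m := fun i => l i / η i) (subset_closure hx.2)] <;>
    rw [residue_add_mul_div]
  exact subset_closure hx.1

theorem exists_lipschitzOnWith_s (h : IsCoupledProblem N k M R Ωa Ωs dec 𝒯c v) (hη : η ∈ R) :
    ∃ C, LipschitzOnWith C v Ωs := by
  obtain ⟨C, hC⟩ := h.exists_lipschitzOnWith_gluedField hη 0
  refine ⟨C, fun x hx y hy => ?_⟩
  rw [h.gluedField_eqOn_s hη 0 hx, h.gluedField_eqOn_s hη 0 hy]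
  exact hC (h.splitting.s_subset_domain hx) (h.splitting.s_subset_domain hy)

theorem exists_lipschitzOnWith_localField (h : IsCoupledProblem N k M R Ωa Ωs dec 𝒯c v)
    (hη : η ∈ R) (l : LPt) :
    ∃ C, LipschitzOnWith C (localField N M Ωa Ωs dec v η l) (bondVolume N η l ∩ Ωa) := by
  obtain ⟨C, hC⟩ := h.exists_lipschitzOnWith_gluedField hη (residue η l)
  refine ⟨C, fun x hx y hy => ?_⟩
  rw [h.gluedField_eqOn_bondVolume hη l hx, h.gluedField_eqOn_bondVolume hη l hy]
  exact hC (h.splitting.a_subset_domain hx.2) (h.splitting.a_subset_domain hy.2)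

theorem integrableOn_fderiv_gluedField (h : IsCoupledProblem N k M R Ωa Ωs dec 𝒯c v) (hη : η ∈ R)
    (r : LPt) (d : Pt) :
    IntegrableOn (fun x => fderiv ℝ (gluedField N M Ωa Ωs dec v η r) x d) (domain M) :=
  let ⟨_, hC⟩ := h.exists_lipschitzOnWith_gluedField hη r
  integrableOn_fderiv_apply (convex_domain M) (isCompact_domain M) hC d

theorem setIntegral_gluedField_add_eq_zero (h : IsCoupledProblem N k M R Ωa Ωs dec 𝒯c v)
    (hη : η ∈ R) (r : LPt) (d : Pt) :
    (∫ x in Ωs, fderiv ℝ v x d) + ∫ x in Ωa, fderiv ℝ (gluedField N M Ωa Ωs dec v η r) x d = 0 := by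
  have hint := h.integrableOn_fderiv_gluedField hη r d
  rw [setIntegral_fderiv_congr h.splitting.region_s.isOpen (h.gluedField_eqOn_s hη r), add_comm,
    ← setIntegral_union h.splitting.disjoint h.splitting.region_s.isOpen.measurableSet
      (hint.mono_set h.splitting.a_subset_domain) (hint.mono_set h.splitting.s_subset_domain),
    setIntegral_congr_set (h.splitting.union_ae_eq_domain h.mesh.decomposition)]
  exact h.integral_fderiv_gluedField hη r d

theorem biUnion_bondVolume_ae_eq (h : IsCoupledProblem N k M R Ωa Ωs dec 𝒯c v) (hη : η ∈ R)
    {r : LPt} (hr : r ∈ residues η) :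
    (⋃ l ∈ {l ∈ latticePeriod N M | residue η l = r}, bondVolume N η l ∩ Ωa) =ᵐ[volume] Ωa := by
  have hb := h.bond η hη
  filter_upwards [ae_mem_bondVolume h.pos hb r] with x hx
  refine propext ⟨fun hu => ?_, fun hxa => ?_⟩
  · obtain ⟨l, -, hl⟩ := mem_iUnion₂.1 hu
    exact hl.2
  · have hdomain := h.splitting.distance η hη _ ⟨x, subset_closure hx, subset_closure hxa⟩
      (latticePt_mem_closure_bondVolume h.pos hb _)
    exact mem_iUnion₂.2 ⟨cellIndex N η r x, Finset.mem_filter.2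
      ⟨mem_latticePeriod h.pos (interior_subset hdomain), residue_add_mul hr _⟩, hx, hxa⟩

theorem setIntegral_gluedField_eq_sum (h : IsCoupledProblem N k M R Ωa Ωs dec 𝒯c v) (hη : η ∈ R)
    {r : LPt} (hr : r ∈ residues η) :
    ∫ x in Ωa, fderiv ℝ (gluedField N M Ωa Ωs dec v η r) x (toVec η) =
      ∑ l ∈ latticePeriod N M with residue η l = r, boxStrain N M Ωa Ωs dec v η l := by
  have hopen : ∀ l, IsOpen (bondVolume N η l ∩ Ωa) := fun l =>
    (isOpen_bondVolume N η l).inter h.splitting.region_a.isOpen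
  rw [← setIntegral_congr_set (h.biUnion_bondVolume_ae_eq hη hr), integral_biUnion_finset]
  · refine Finset.sum_congr rfl fun l hl => ?_
    rw [boxStrain, setIntegral_fderiv_congr (hopen l) (h.gluedField_eqOn_bondVolume hη l),
      (Finset.mem_filter.1 hl).2]
  · exact fun l _ => (hopen l).measurableSet
  · refine fun l hl l' hl' hne => Set.disjoint_left.2 fun x hx hx' => hne ?_
    rw [← cellIndex_residue_of_mem h.pos (h.bond η hη) hx.1,
      ← cellIndex_residue_of_mem h.pos (h.bond η hη) hx'.1,
      (Finset.mem_filter.1 hl).2, (Finset.mem_filter.1 hl').2]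
  · exact fun l _ => (h.integrableOn_fderiv_gluedField hη r _).mono_set
      (inter_subset_right.trans h.splitting.a_subset_domain)

theorem smul_integral_add_sum_boxStrain (h : IsCoupledProblem N k M R Ωa Ωs dec 𝒯c v)
    (hη : η ∈ R) :
    |((η 0 * η 1 * η 2 : ℤ) : ℝ)| • (∫ x in Ωs, fderiv ℝ v x (toVec η)) +
      ∑ l ∈ latticePeriod N M, boxStrain N M Ωa Ωs dec v η l = 0 := by
  have hclass : ∀ r ∈ residues η, (∫ x in Ωs, fderiv ℝ v x (toVec η)) +
      ∑ l ∈ latticePeriod N M with residue η l = r, boxStrain N M Ωa Ωs dec v η l = 0 :=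
    fun r hr => by
      rw [← h.setIntegral_gluedField_eq_sum hη hr, h.setIntegral_gluedField_add_eq_zero hη]
  have hsum := Finset.sum_eq_zero hclass
  rwa [Finset.sum_add_distrib, Finset.sum_const, ← Nat.cast_smul_eq_nsmul ℝ, card_residues,
    Finset.sum_fiberwise_of_maps_to fun l _ => residue_mem_residues (h.bond η hη) l] at hsum

theorem boxStrain_of_inAtomistic (h : IsCoupledProblem N k M R Ωa Ωs dec 𝒯c v) (hη : η ∈ R)
    {l : LPt} (hl : InAtomistic N Ωa η l) : boxStrain N M Ωa Ωs dec v η l =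
      (spacing N ^ 3 * |((η 0 * η 1 * η 2 : ℤ) : ℝ)|) • diffQuot N η v l := by
  obtain ⟨C, hC⟩ := h.exists_lipschitzOnWith_localField hη l
  have hopen := isOpen_bondVolume N η l
  rw [boxStrain, inter_eq_left.2 (subset_closure.trans hl), ← volume_bondVolume h.pos η l,
    ← setIntegral_const]
  rw [inter_eq_left.2 (subset_closure.trans hl), localField, if_pos hl] at hC
  refine setIntegral_congr_ae hopen.measurableSet ?_
  filter_upwards [hC.ae_differentiableWithinAt_of_mem (μ := volume)] with x hdiff hx
  rw [localField, if_pos hl]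
  have hline : HasLineDerivAt ℝ (interpolant N (typeA l η) v) (diffQuot N η v l) x (toVec η) :=
    (hasDerivAt_add_smul_const _ _ 0).congr_of_eventuallyEq
      (interpolant_typeA_add_smul h.pos (h.bond η hη) hx v)
  have hd := (hdiff hx).differentiableAt (hopen.mem_nhds hx)
  exact (hd.hasFDerivAt.hasLineDerivAt (toVec η)).unique hline

theorem boxStrain_of_inContinuum (h : IsCoupledProblem N k M R Ωa Ωs dec 𝒯c v) (hη : η ∈ R)
    {l : LPt} (hl : InContinuum N M Ωs η l) : boxStrain N M Ωa Ωs dec v η l = 0 := by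
  have hempty : bondVolume N η l ∩ Ωa = ∅ := eq_empty_iff_forall_notMem.2 fun x ⟨hx, hxa⟩ =>
    h.splitting.notMem_closure_s hxa (subset_closure (h.splitting.bondVolume_subset_of_inContinuum
      hη (subset_closure hx) (subset_closure hxa) hl hx))
  rw [boxStrain, hempty, setIntegral_empty]

open Classical in
theorem sum_boxStrain_eq (h : IsCoupledProblem N k M R Ωa Ωs dec 𝒯c v) (hη : η ∈ R) :
    ∑ l ∈ latticePeriod N M, boxStrain N M Ωa Ωs dec v η l =
      (spacing N ^ 3 * |((η 0 * η 1 * η 2 : ℤ) : ℝ)|) •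
        ∑ l ∈ latticePeriod N M with InAtomistic N Ωa η l, diffQuot N η v l +
      ∑ l ∈ latticePeriod N M with AtInterface N M Ωa Ωs η l,
        boxStrain N M Ωa Ωs dec v η l := by
  rw [Finset.smul_sum, Finset.sum_filter, Finset.sum_filter, ← Finset.sum_add_distrib]
  refine Finset.sum_congr rfl fun l _ => ?_
  by_cases ha : InAtomistic N Ωa η l
  · rw [if_pos ha, if_neg fun hc => hc.1 ha, add_zero, h.boxStrain_of_inAtomistic hη ha]
  by_cases hb : InContinuum N M Ωs η l
  · rw [if_neg ha, if_neg fun hc => hc.2 hb, add_zero, h.boxStrain_of_inContinuum hη hb]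
  · rw [if_neg ha, if_pos ⟨ha, hb⟩, zero_add]

open Classical in
theorem strain_balance (h : IsCoupledProblem N k M R Ωa Ωs dec 𝒯c v) (hη : η ∈ R) :
    spacing N ^ 3 • (∑ l ∈ latticePeriod N M with InAtomistic N Ωa η l, diffQuot N η v l) +
      (∫ x in Ωs, fderiv ℝ v x (toVec η)) +
      ∑ l ∈ latticePeriod N M with AtInterface N M Ωa Ωs η l,
        (1 / |((η 0 * η 1 * η 2 : ℤ) : ℝ)|) • boxStrain N M Ωa Ωs dec v η l = 0 := by
  have hq : |((η 0 * η 1 * η 2 : ℤ) : ℝ)| ≠ 0 := by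
    have hb := h.bond η hη
    exact abs_ne_zero.2 (Int.cast_ne_zero.2 (mul_ne_zero (mul_ne_zero (hb 0) (hb 1)) (hb 2)))
  have htotal := h.smul_integral_add_sum_boxStrain hη
  rw [h.sum_boxStrain_eq hη] at htotal
  rw [← Finset.smul_sum]
  refine (smul_eq_zero_iff_right hq).1 (Eq.trans ?_ htotal)
  generalize |((η 0 * η 1 * η 2 : ℤ) : ℝ)| = q at hq
  match_scalars <;> field_simp

theorem hasDerivAt_energyContinuum (h : IsCoupledProblem N k M R Ωa Ωs dec 𝒯c v) (hη : η ∈ R)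
    (F : Matrix (Fin 3) (Fin 3) ℝ) {φ : Pt → ℝ} (hφm : Measurable φ)
    (hφ : DifferentiableAt ℝ φ (F.mulVec (toVec η))) :
    HasDerivAt (fun t : ℝ => energyContinuum Ωs φ η fun x => F.mulVec x + t • v x)
      (fderiv ℝ φ (F.mulVec (toVec η)) (∫ x in Ωs, fderiv ℝ v x (toVec η))) 0 := by
  obtain ⟨C, hC⟩ := h.exists_lipschitzOnWith_s hη
  exact hasDerivAt_setIntegral_comp_fderiv h.splitting.region_s.isOpen
    (measure_ne_top_of_subset h.splitting.s_subset_domain (isCompact_domain M).measure_ne_top) hC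
    F.mulVecLin.toContinuousLinearMap (toVec η) hφm hφ fun t x _ => rfl

open Classical in
theorem hasDerivAt_energyInterface (h : IsCoupledProblem N k M R Ωa Ωs dec 𝒯c v) (hη : η ∈ R)
    (F : Matrix (Fin 3) (Fin 3) ℝ) {φ : Pt → ℝ} (hφm : Measurable φ)
    (hφ : DifferentiableAt ℝ φ (F.mulVec (toVec η))) :
    HasDerivAt (fun t : ℝ => energyInterface N M Ωa Ωs dec φ η fun x => F.mulVec x + t • v x)
      (fderiv ℝ φ (F.mulVec (toVec η))
        (∑ l ∈ latticePeriod N M with AtInterface N M Ωa Ωs η l,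
          (1 / |((η 0 * η 1 * η 2 : ℤ) : ℝ)|) • boxStrain N M Ωa Ωs dec v η l)) 0 := by
  simp only [energyInterface, map_sum, map_smul, smul_eq_mul,
    setIntegral_indicator h.splitting.region_a.isOpen.measurableSet]
  refine HasDerivAt.fun_sum fun l hl => HasDerivAt.const_mul _ ?_
  obtain ⟨ha, hb⟩ := (Finset.mem_filter.1 hl).2
  obtain ⟨C, hC⟩ := h.exists_lipschitzOnWith_localField hη l
  refine hasDerivAt_setIntegral_comp_fderiv
    ((isOpen_bondVolume N η l).inter h.splitting.region_a.isOpen)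
    (measure_ne_top_of_subset (inter_subset_right.trans h.splitting.a_subset_domain)
      (isCompact_domain M).measure_ne_top) hC
    F.mulVecLin.toContinuousLinearMap (toVec η) hφm hφ fun t x hx => ?_
  rw [localField, if_neg ha, if_neg hb]
  exact interpolant_mulVec_add h.pos ((h.interfaceDec.decomposition η hη l ⟨ha, hb⟩).exists_mem_hull
    (subset_closure hx.1)) F t v

theorem hasDerivAt_coupledEnergy (h : IsCoupledProblem N k M R Ωa Ωs dec 𝒯c v)
    (F : Matrix (Fin 3) (Fin 3) ℝ) {φ : LPt → Pt → ℝ} (hφm : ∀ η ∈ R, Measurable (φ η))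
    (hφ : ∀ η ∈ R, DifferentiableAt ℝ (φ η) (F.mulVec (toVec η))) :
    HasDerivAt (fun t : ℝ => coupledEnergy N M R φ Ωa Ωs dec fun x => F.mulVec x + t • v x)
      0 0 := by
  refine (HasDerivAt.fun_sum (A' := fun _ => (0 : ℝ)) fun η hη => ?_).congr_deriv
    Finset.sum_const_zero
  have hsum := ((hasDerivAt_energyAtomistic h.pos M Ωa η F (hφ η hη) v).add
    (h.hasDerivAt_energyContinuum hη F (hφm η hη) (hφ η hη))).add
    (h.hasDerivAt_energyInterface hη F (hφm η hη) (hφ η hη))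
  rw [← map_add, ← map_add, h.strain_balance hη, map_zero] at hsum
  exact hsum

end IsCoupledProblem

end ACCoupling

end

theorem proposition6p1_general
    (N k : ℕ) (hN : 0 < N) (M : Fin 3 → ℕ)
    (R : Finset ACCoupling.LPt) (hR : ∀ η ∈ R, η 0 * η 1 * η 2 ≠ 0)
    (F : Matrix (Fin 3) (Fin 3) ℝ)
    (φ : ACCoupling.LPt → ACCoupling.Pt → ℝ) (hφm : ∀ η ∈ R, Measurable (φ η))
    (hφ : ∀ η ∈ R, DifferentiableAt ℝ (φ η) (F.mulVec (ACCoupling.toVec η)))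
    (Ωa Ωs : Set ACCoupling.Pt) (hΩ : ACCoupling.IsSplitting N M R Ωa Ωs)
    (dec : ACCoupling.LPt → ACCoupling.LPt → Finset (Finset ACCoupling.LPt))
    (hdec : ACCoupling.IsInterfaceDecomposition N M R Ωa Ωs dec)
    (𝒯c : Finset (Finset ACCoupling.LPt)) (h𝒯c : ACCoupling.IsContinuumMesh N Ωa Ωs 𝒯c)
    (v : ACCoupling.Pt → ACCoupling.Pt)
    (hv : ACCoupling.MemCoupledSpace N k M Ωa Ωs 𝒯c v) :
    HasDerivAt
      (fun t : ℝ => ACCoupling.coupledEnergy N M R φ Ωa Ωs dec (fun x => F.mulVec x + t • v x))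
      0 0 := by
  have hbond : ∀ η ∈ R, ∀ i, η i ≠ 0 := fun η hη i hi => hR η hη (by fin_cases i <;> simp_all)
  exact ACCoupling.IsCoupledProblem.hasDerivAt_coupledEnergy (k := k)
    ⟨hN, hbond, hΩ, hdec, h𝒯c, hv⟩ F hφm hφ

theorem proposition6p1
    (N k : ℕ) (hN : 0 < N) (M : Fin 3 → ℕ) (hM : ∀ i, 0 < M i)
    (R : Finset ACCoupling.LPt) (hR : ∀ η ∈ R, η 0 * η 1 * η 2 ≠ 0)
    (φ : ACCoupling.LPt → ACCoupling.Pt → ℝ) (hφ : ∀ η ∈ R, ContDiff ℝ 1 (φ η))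
    (Ωa Ωs : Set ACCoupling.Pt) (hΩ : ACCoupling.IsSplitting N M R Ωa Ωs)
    (dec : ACCoupling.LPt → ACCoupling.LPt → Finset (Finset ACCoupling.LPt))
    (hdec : ACCoupling.IsInterfaceDecomposition N M R Ωa Ωs dec)
    (𝒯c : Finset (Finset ACCoupling.LPt)) (h𝒯c : ACCoupling.IsContinuumMesh N Ωa Ωs 𝒯c)
    (F : Matrix (Fin 3) (Fin 3) ℝ) (hF : 0 < F.det)
    (v : ACCoupling.Pt → ACCoupling.Pt)
    (hv : ACCoupling.MemCoupledSpace N k M Ωa Ωs 𝒯c v) :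
    HasDerivAt
      (fun t : ℝ => ACCoupling.coupledEnergy N M R φ Ωa Ωs dec (fun x => F.mulVec x + t • v x))
      0 0 := by
  exact proposition6p1_general N k hN M R hR F φ (fun η hη => (hφ η hη).continuous.measurable)
    (fun η hη => (hφ η hη).differentiable one_ne_zero _) Ωa Ωs hΩ dec hdec 𝒯c h𝒯c v hv
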